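/- Let $\delta\in(0,1)$, $\Lambda>0$ and $c>0$. There is a constant $C>0$, depending only on $\delta,\Lambda,c$, such that the following holds. **Model.** Let $n,m\ge 1$, let $\mathcal Y\subset\mathbb R$ be closed, and let $x_0\in\mathbb R^n$ with $\|x_0\|=1$ (Euclidean norm). Let $a_1,\dots,a_m\sim N(0,I_n)$ and let $f_1,\dots,f_m$ be copies of a (possibly random, jointly measurable) function $f:\mathbb R\to\mathcal Y$, such that $f_i$ is independent of $a_i$ and the pairs $(a_1,f_1),\dots,(a_m,f_m)$ are independent. Put $y_i=f_i(\langle a_i,x_0\rangle)$. The actual observations form a random vector $\tilde y=(\tilde y_1,\dots,\tilde y_m)\in\mathcal Y^m$ that may depend arbitrarily on all of these data, and $$\varepsilon=\Big(\frac1m\sum_{i=1}^m|\tilde y_i-y_i|^2\Big)^{1/2}.$$ **Loss.** Let $\mathcal L:\mathbb R\times\mathcal Y\to\mathbb R$, $(v,y)\mapsto\mathcal L(v,y)$, be convex and continuously differentiable in $v$, with derivative $\mathcal L'=\partial\mathcal L/\partial v$ satisfying $|\mathcal L'(v,y)-\mathcal L'(v,y')|\le\Lambda|y-y'|$ for all $v\in\mathbb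 R$, $y,y'\in\mathcal Y$. Write $\bar{\mathcal L}(x)=\frac1m\sum_{i=1}^m\mathcal L(\langle a_i,x\rangle,\tilde y_i)$ for the empirical loss. **Parameters.** With $g\sim N(0,1)$ independent of $f$, put $$\sigma^2=\mathbb E[\mathcal L'(\mu g,f(g))^2],\qquad \eta^2=\mathbb E[\mathcal L'(\mu g,f(g))^2g^2],$$ where $\mu\in\mathbb R$ is a solution of $\mathbb E[\mathcal L'(\mu g,f(g))\,g]=0$ for which $\sigma,\eta<\infty$ (it is assumed that such a $\mu$ exists). **Signal set.** Let $K\subset\mathbb R^n$ be convex with $\mu x_0\in K$, and let $t>0$. With $\mathbf g\sim N(0,I_n)$ put $$d_t=d_t(K-\mu x_0)=\frac1{t^2}\Big(\mathbb E\sup\{\langle \mathbf g,h\rangle: h\in K-\mu x_0,\ \|h\|\le t\}\Big)^2,$$ and assume $m\ge d_t$. **Conclusion.** With probability at least $1-\delta$ the following is true: if the empirical loss satisfies restricted strong convexity at scale $t$ with constant $c$, that is, $$\bar{\mathcal L}(x)-\bar{\mathcal L}(\mu x_0)-\langle\nabla\bar{\mathcal L}(\mu x_0),x-\mu x_0\rangle\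 \ge\ c\,\|x-\mu x_0\|^2\qquad\text{for all }x\in K\text{ with }\|x-\mu x_0\|=t,$$ and if $$t>C\cdot\Big(\frac{\sigma\sqrt{d_t}+\eta}{\sqrt m}+\varepsilon\Big),$$ then every minimizer $\hat x$ of $\bar{\mathcal L}$ over $K$ satisfies $\|\hat x-\mu x_0\|\le t$. -/

import Mathlib

open MeasureTheory ProbabilityTheory
open scoped InnerProductSpace

noncomputable section

namespace SingleIndex

/-! ### Gaussian mean width -/

/-- The Gaussian mean width `w(L) = E[sup_{x ∈ L} ⟨g, x⟩]`, with `g` a standard Gaussian vector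
(used for nonempty bounded `L`). -/
def meanWidth {n : ℕ} (L : Set (EuclideanSpace ℝ (Fin n))) : ℝ :=
  ∫ g, (⨆ x : L, ⟪g, (x : EuclideanSpace ℝ (Fin n))⟫_ℝ)
    ∂(stdGaussian (EuclideanSpace ℝ (Fin n)))

/-- The local mean width `w_t(L) = w(L ∩ t B)`, with `B` the closed Euclidean unit ball. -/
def localMeanWidth {n : ℕ} (t : ℝ) (L : Set (EuclideanSpace ℝ (Fin n))) : ℝ :=
  meanWidth (L ∩ Metric.closedBall 0 t)

/-- The local effective dimension `d_t(L) = w_t(L)² / t²`. -/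
def effDim {n : ℕ} (t : ℝ) (L : Set (EuclideanSpace ℝ (Fin n))) : ℝ :=
  localMeanWidth t L ^ 2 / t ^ 2

/-! ### Loss functions -/

/-- The partial derivative `ℒ'(v, y)` of the loss in its first variable. -/
def lossDeriv {𝒴 : Set ℝ} (ℒ : ℝ → 𝒴 → ℝ) (v : ℝ) (y : 𝒴) : ℝ :=
  deriv (fun u => ℒ u y) v

/-- The regularity assumptions on the loss: it is continuously differentiable and convex in the
first variable, and its derivative is Lipschitz in the second variable with constant `Λ`. -/
structure IsRegularLoss {𝒴 : Set ℝ} (ℒ : ℝ → 𝒴 → ℝ) (Λ : ℝ) : Prop where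
  contDiff : ∀ y : 𝒴, ContDiff ℝ 1 (fun v => ℒ v y)
  lipschitz : ∀ (v : ℝ) (y y' : 𝒴),
    |lossDeriv ℒ v y - lossDeriv ℒ v y'| ≤ Λ * |(y : ℝ) - (y' : ℝ)|
  convex : ∀ y : 𝒴, ConvexOn ℝ Set.univ (fun v => ℒ v y)

/-- The empirical loss `x ↦ (1/m) ∑ᵢ ℒ(⟨aᵢ, x⟩, yᵢ)`. -/
def empLoss {n m : ℕ} {𝒴 : Set ℝ} (ℒ : ℝ → 𝒴 → ℝ)
    (a : Fin m → EuclideanSpace ℝ (Fin n)) (y : Fin m → 𝒴)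
    (x : EuclideanSpace ℝ (Fin n)) : ℝ :=
  (1 / (m : ℝ)) * ∑ i, ℒ ⟪a i, x⟫_ℝ (y i)

/-- The first order Taylor error of the empirical loss at the base point `b`. -/
def taylorError {n m : ℕ} {𝒴 : Set ℝ} (ℒ : ℝ → 𝒴 → ℝ)
    (a : Fin m → EuclideanSpace ℝ (Fin n)) (y : Fin m → 𝒴)
    (x b : EuclideanSpace ℝ (Fin n)) : ℝ :=
  empLoss ℒ a y x - empLoss ℒ a y b - ⟪gradient (empLoss ℒ a y) b, x - b⟫_ℝ

/-- Restricted strong convexity of the empirical loss at scale `t` with respect to the base point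
`b` and the set `K`, with RSC-constant `c`. -/
def RSCWith {n m : ℕ} {𝒴 : Set ℝ} (c : ℝ) (ℒ : ℝ → 𝒴 → ℝ)
    (a : Fin m → EuclideanSpace ℝ (Fin n)) (y : Fin m → 𝒴) (t : ℝ)
    (b : EuclideanSpace ℝ (Fin n)) (K : Set (EuclideanSpace ℝ (Fin n))) : Prop :=
  ∀ x ∈ K ∩ Metric.sphere b t, c * ‖x - b‖ ^ 2 ≤ taylorError ℒ a y x b

/-- `xhat` is a minimizer of the empirical loss subject to the constraint `x ∈ K`. -/
def IsEstimate {n m : ℕ} {𝒴 : Set ℝ} (ℒ : ℝ → 𝒴 → ℝ)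
    (a : Fin m → EuclideanSpace ℝ (Fin n)) (y : Fin m → 𝒴)
    (K : Set (EuclideanSpace ℝ (Fin n))) (xhat : EuclideanSpace ℝ (Fin n)) : Prop :=
  xhat ∈ K ∧ IsMinOn (empLoss ℒ a y) K xhat

/-! ### Observation model

A random function is `f : ℝ → S → 𝒴`, where `(S, ν)` is the probability space that carries its
randomness; the independent copies of it are `f · (ξ i)` with `ξ i` independent of law `ν`. -/

/-- The random measurement data: the pairs `(aᵢ, ξᵢ)` are independent of each other, `aᵢ` is
standard Gaussian, `ξᵢ` has law `ν`, and `ξᵢ` is independent of `aᵢ`. -/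
structure IsGaussianSample {Ω S : Type*} [MeasurableSpace Ω] [MeasurableSpace S] {n m : ℕ}
    (P : Measure Ω) (ν : Measure S) (a : Fin m → Ω → EuclideanSpace ℝ (Fin n))
    (ξ : Fin m → Ω → S) : Prop where
  law_vector : ∀ i, HasLaw (a i) (stdGaussian (EuclideanSpace ℝ (Fin n))) P
  law_noise : ∀ i, HasLaw (ξ i) ν P
  indep_noise : ∀ i, IndepFun (a i) (ξ i) P
  indep : iIndepFun (fun i ω => (a i ω, ξ i ω)) P

/-- The clean observations `yᵢ = fᵢ(⟨aᵢ, x₀⟩)`. -/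
def observation {S : Type*} {n m : ℕ} {𝒴 : Set ℝ} (f : ℝ → S → 𝒴)
    (a : Fin m → EuclideanSpace ℝ (Fin n)) (s : Fin m → S)
    (x₀ : EuclideanSpace ℝ (Fin n)) (i : Fin m) : 𝒴 :=
  f ⟪a i, x₀⟫_ℝ (s i)

/-- The adversarial noise parameter `ε = ((1/m) ∑ᵢ |ỹᵢ - yᵢ|²)^{1/2}`. -/
def advNoise {m : ℕ} {𝒴 : Set ℝ} (ytilde y : Fin m → 𝒴) : ℝ :=
  Real.sqrt ((1 / (m : ℝ)) * ∑ i, |(ytilde i : ℝ) - (y i : ℝ)| ^ 2)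

/-! ### Model parameters -/

/-- The residual `ℒ'(μ g, f(g))` as a random variable on the space of pairs `(g, s)`. -/
def lossResidual {S : Type*} {𝒴 : Set ℝ} (ℒ : ℝ → 𝒴 → ℝ) (f : ℝ → S → 𝒴) (μ : ℝ) (p : ℝ × S) : ℝ :=
  lossDeriv ℒ (μ * p.1) (f p.1 p.2)

/-- The joint law of `(g, s)`: `g` is standard normal and independent of the randomness of `f`. -/
def refLaw {S : Type*} [MeasurableSpace S] (ν : Measure S) : Measure (ℝ × S) :=
  (gaussianReal 0 1).prod ν

/-- `μ` is a scaling parameter: `σ²` and `η²` are finite, and `E[ℒ'(μ g, f(g)) · g] = 0`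
(this expectation exists because `η²` is finite). -/
structure IsScalingParameter {S : Type*} [MeasurableSpace S] {𝒴 : Set ℝ} (ℒ : ℝ → 𝒴 → ℝ)
    (f : ℝ → S → 𝒴) (ν : Measure S) (μ : ℝ) : Prop where
  integrable_sigma : Integrable (fun p => lossResidual ℒ f μ p ^ 2) (refLaw ν)
  integrable_eta : Integrable (fun p => lossResidual ℒ f μ p ^ 2 * p.1 ^ 2) (refLaw ν)
  mean_zero : ∫ p, lossResidual ℒ f μ p * p.1 ∂(refLaw ν) = 0

/-- `σ = E[ℒ'(μ g, f(g))²]^{1/2}`. -/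
def sigmaParam {S : Type*} [MeasurableSpace S] {𝒴 : Set ℝ} (ℒ : ℝ → 𝒴 → ℝ)
    (f : ℝ → S → 𝒴) (ν : Measure S) (μ : ℝ) : ℝ :=
  Real.sqrt (∫ p, lossResidual ℒ f μ p ^ 2 ∂(refLaw ν))

/-- `η = E[ℒ'(μ g, f(g))² · g²]^{1/2}`. -/
def etaParam {S : Type*} [MeasurableSpace S] {𝒴 : Set ℝ} (ℒ : ℝ → 𝒴 → ℝ)
    (f : ℝ → S → 𝒴) (ν : Measure S) (μ : ℝ) : ℝ :=
  Real.sqrt (∫ p, lossResidual ℒ f μ p ^ 2 * p.1 ^ 2 ∂(refLaw ν))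

end SingleIndex

end

/-!
Write `b = μ x₀`, `T = (K - b) ∩ t B`, and let `Z(g) = sup_{h ∈ T} ⟨g, h⟩` be the support function
of `T`, so that `E Z = w = t √d` for a standard Gaussian vector.

By convexity of the loss and of `K`, a minimizer at distance more than `t` from `b` would give a
point `b + h` of `K` with `‖h‖ = t` and loss at most the loss at `b`. Restricted strong convexity
excludes this as soon as `-⟨∇L(b), h⟩ < c t²` for all such `h`
(`IsRegularLoss.norm_estimate_sub_le`). The gradient splits into three parts
(`neg_sum_residual_inner_le`), where `zᵢ` are the clean residuals and `gᵢ = ⟨aᵢ, x₀⟩`: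

* along `x₀`, a sum of the independent centered variables `zᵢ gᵢ` of variance `η²`, controlled by
  Chebyshev's inequality (`lintegral_parallel_noise_sq_le`);
* orthogonal to `x₀`, where the Gaussian components are independent of the residuals, so that the
  sum is distributed as a projected Gaussian vector times the norm of the residual vector, and the
  expected supremum is at most `√m σ w` (`lintegral_supportFun_orthogonal_noise_le`);
* the adversarial part, at most `Λ √m ε (∑ᵢ ⟨aᵢ, h⟩²)^{1/2}` by the Cauchy-Schwarz inequality.

The last factor has to be bounded by `√m t` uniformly in `h ∈ T`. No Gaussian comparison inequality
is needed: since `exp(l² ∑ᵢ ⟨aᵢ, h⟩² / 2) = E_γ exp(l ∑ᵢ γᵢ ⟨aᵢ, h⟩)` is at most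
`E_γ exp(l Z(∑ᵢ γᵢ aᵢ))`, which does not depend on `h`, and `∑ᵢ γᵢ aᵢ` is distributed as `‖γ‖ g`,
it is enough to know the exponential moments of `Z` (`lintegral_gaussianMix_le`).
These come from Gaussian concentration, `E exp(s Z) ≤ exp(s w + π² s² t² / 8)`
(`lintegral_exp_lipschitz_stdGaussian_le`), which is proved by integrating along the rotation of two
independent Gaussian vectors, with Rademacher's theorem supplying the derivative of `Z`.
The three exceptional events are combined in `exists_noise_exceptional_set`.
-/

/-! ### Standard Gaussian vectors -/

namespace SingleIndex

/-- Absolute continuity passes to finite powers of measures on the line. -/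
lemma absolutelyContinuous_pi_fin {α β : Measure ℝ} [SigmaFinite α] [SigmaFinite β]
    (h : α ≪ β) (k : ℕ) :
    Measure.pi (fun _ : Fin k => α) ≪ Measure.pi (fun _ : Fin k => β) := by
  induction k with
  | zero =>
    rw [Measure.pi_of_empty, Measure.pi_of_empty]
  | succ k ih =>
    have h1 := (measurePreserving_piFinSuccAbove (fun _ : Fin (k + 1) => α) 0).symm
    have h2 := (measurePreserving_piFinSuccAbove (fun _ : Fin (k + 1) => β) 0).symm
    rw [← h1.map_eq, ← h2.map_eq]
    exact (h.prod ih).map (MeasurableEquiv.measurable _)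

section Basic

variable {E : Type*} [NormedAddCommGroup E] [InnerProductSpace ℝ E] [FiniteDimensional ℝ E]
  [MeasurableSpace E] [BorelSpace E]

lemma stdGaussian_absolutelyContinuous : stdGaussian E ≪ (volume : Measure E) := by
  have h1 : stdGaussian (EuclideanSpace ℝ (Fin (Module.finrank ℝ E))) ≪ volume := by
    rw [← map_pi_eq_stdGaussian,
      ← (PiLp.volume_preserving_toLp (Fin (Module.finrank ℝ E))).map_eq, volume_pi]
    exact (absolutelyContinuous_pi_fin
      (gaussianReal_absolutelyContinuous 0 one_ne_zero) _).map (by fun_prop)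
  have e := (stdOrthonormalBasis ℝ E).repr.symm
  rw [← stdGaussian_map e, ← e.measurePreserving.map_eq]
  exact h1.map e.continuous.measurable

lemma lintegral_exp_dual_stdGaussian (L : StrongDual ℝ E) :
    ∫⁻ x, ENNReal.ofReal (Real.exp (L x)) ∂(stdGaussian E)
      = ENNReal.ofReal (Real.exp (‖L‖ ^ 2 / 2)) := by
  have hmap : (stdGaussian E).map L = gaussianReal 0 (Real.toNNReal (‖L‖ ^ 2)) := by
    rw [IsGaussian.map_eq_gaussianReal, integral_strongDual_stdGaussian,
      variance_dual_stdGaussian]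
  have hint : Integrable (fun x => Real.exp (L x)) (stdGaussian E) := by
    have h := integrable_exp_mul_gaussianReal (μ := 0) (v := Real.toNNReal (‖L‖ ^ 2)) 1
    rw [← hmap, integrable_map_measure (by fun_prop) (by fun_prop)] at h
    simpa [Function.comp_def] using h
  rw [← ofReal_integral_eq_lintegral_ofReal hint (ae_of_all _ fun _ => (Real.exp_pos _).le)]
  congr 1
  have h := mgf_gaussianReal hmap 1
  simpa [mgf, Real.coe_toNNReal _ (sq_nonneg ‖L‖)] using h

lemma lintegral_exp_inner_stdGaussian (v : E) :
    ∫⁻ x, ENNReal.ofReal (Real.exp ⟪x, v⟫_ℝ) ∂(stdGaussian E)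
      = ENNReal.ofReal (Real.exp (‖v‖ ^ 2 / 2)) := by
  have h := lintegral_exp_dual_stdGaussian (innerSL ℝ v)
  simpa [real_inner_comm] using h

/-- A linear combination of independent standard Gaussian vectors is a standard Gaussian vector
scaled by the Euclidean norm of the coefficients. -/
lemma map_sum_smul_stdGaussian {m : ℕ} (z : Fin m → ℝ) :
    (Measure.pi (fun _ : Fin m => stdGaussian E)).map (fun a => ∑ i, z i • a i)
      = (stdGaussian E).map (fun x => Real.sqrt (∑ i, z i ^ 2) • x) := by
  have h1 : (Measure.pi (fun _ : Fin m => stdGaussian E)).map (fun a => ∑ i, z i • a i)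
      = (Measure.pi (fun i : Fin m => (stdGaussian E).map (fun x => z i • x))).map
          (fun a => ∑ i, a i) := by
    rw [← Measure.pi_map_pi (by fun_prop), Measure.map_map (by fun_prop) (by fun_prop)]
    rfl
  have : ∀ i, IsProbabilityMeasure ((stdGaussian E).map (fun x => z i • x)) :=
    fun i => Measure.isProbabilityMeasure_map (by fun_prop)
  rw [h1]
  apply Measure.ext_of_charFun
  rw [charFun_map_sum_pi_eq_prod]
  ext u
  simp only [Finset.prod_apply, charFun_map_smul, charFun_stdGaussian, ← Complex.exp_sum]
  congr 1
  rw [norm_smul, Real.norm_eq_abs, abs_of_nonneg (Real.sqrt_nonneg _)]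
  norm_cast
  rw [mul_pow, Real.sq_sqrt (Finset.sum_nonneg fun i _ => sq_nonneg _), ← Finset.sum_div,
    Finset.sum_neg_distrib, Finset.sum_mul]
  simp [norm_smul, mul_pow]

/-- The linear map that keeps the component along `x₀` of its first argument and the component
orthogonal to `x₀` of its second argument. -/
def spliceAlong (x₀ : E) (p : E × E) : E :=
  ⟪x₀, p.1⟫_ℝ • x₀ + (p.2 - ⟪x₀, p.2⟫_ℝ • x₀)

lemma measurable_spliceAlong (x₀ : E) : Measurable (spliceAlong x₀) := by
  unfold spliceAlong; fun_prop

/-- The components of a standard Gaussian vector along `x₀` and orthogonal to `x₀` are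
independent. -/
lemma map_spliceAlong_stdGaussian {x₀ : E} (hx₀ : ‖x₀‖ = 1) :
    ((stdGaussian E).prod (stdGaussian E)).map (spliceAlong x₀) = stdGaussian E := by
  have hx : ⟪x₀, x₀⟫_ℝ = 1 := by rw [real_inner_self_eq_norm_sq, hx₀]; norm_num
  let A : E → E := fun a => ⟪x₀, a⟫_ℝ • x₀
  let B : E → E := fun a => a - ⟪x₀, a⟫_ℝ • x₀
  have hA : Measurable A := by fun_prop
  have hB : Measurable B := by fun_prop
  have h1 : ((stdGaussian E).prod (stdGaussian E)).map (spliceAlong x₀)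
      = (((stdGaussian E).map A).prod ((stdGaussian E).map B)).map (fun p => p.1 + p.2) := by
    rw [Measure.map_prod_map _ _ hA hB, Measure.map_map (by fun_prop) (by fun_prop)]
    rfl
  have := Measure.isProbabilityMeasure_map (μ := stdGaussian E) hA.aemeasurable
  have := Measure.isProbabilityMeasure_map (μ := stdGaussian E) hB.aemeasurable
  rw [h1]
  apply Measure.ext_of_charFun
  rw [charFun_map_add_prod_eq_mul]
  ext u
  have hAu : charFun ((stdGaussian E).map A) u = charFun (stdGaussian E) (A u) := by
    rw [charFun_apply, charFun_apply, integral_map hA.aemeasurable (by fun_prop)]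
    simp only [A, real_inner_smul_right, real_inner_comm, mul_comm]
  have hBu : charFun ((stdGaussian E).map B) u = charFun (stdGaussian E) (B u) := by
    rw [charFun_apply, charFun_apply, integral_map hB.aemeasurable (by fun_prop)]
    simp only [B, inner_sub_left, inner_sub_right, real_inner_smul_right,
      real_inner_comm, mul_comm]
  rw [Pi.mul_apply, hAu, hBu]
  simp only [charFun_stdGaussian, ← Complex.exp_add]
  congr 1
  norm_cast
  have e1 : ‖A u‖ ^ 2 = ⟪x₀, u⟫_ℝ ^ 2 := by
    simp [A, norm_smul, hx₀]
  have e2 : ‖B u‖ ^ 2 = ‖u‖ ^ 2 - ⟪x₀, u⟫_ℝ ^ 2 := by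
    simp only [B]
    rw [norm_sub_sq_real, norm_smul, hx₀, real_inner_smul_right, real_inner_comm x₀ u]
    simp; ring
  rw [e1, e2]; ring

/-- The reflection in the hyperplane orthogonal to a unit vector preserves the standard Gaussian
measure. -/
lemma map_reflection_stdGaussian {x₀ : E} (hx₀ : ‖x₀‖ = 1) :
    (stdGaussian E).map (fun a => a - (2 * ⟪x₀, a⟫_ℝ) • x₀) = stdGaussian E := by
  have h := stdGaussian_map (E := E) ((ℝ ∙ x₀)ᗮ.reflection)
  convert h using 2
  ext a
  rw [Submodule.reflection_orthogonal_apply, Submodule.reflection_singleton_apply, hx₀]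
  simp [two_smul, two_mul, add_smul]

end Basic

/-- The exponential moment `E exp(‖γ‖² / 4) = √2 ^ m` of a standard Gaussian vector in `ℝᵐ`. -/
lemma lintegral_exp_norm_sq_stdGaussian (m : ℕ) :
    ∫⁻ x, ENNReal.ofReal (Real.exp (‖x‖ ^ 2 / 4)) ∂(stdGaussian (EuclideanSpace ℝ (Fin m)))
      = ENNReal.ofReal (Real.sqrt 2 ^ m) := by
  have hone : ∫⁻ x, ENNReal.ofReal (Real.exp (x ^ 2 / 4)) ∂(gaussianReal 0 1)
      = ENNReal.ofReal (Real.sqrt 2) := by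
    rw [gaussianReal_of_var_ne_zero _ one_ne_zero,
      lintegral_withDensity_eq_lintegral_mul _ (by fun_prop) (by fun_prop)]
    have hpt : ∀ x : ℝ, (gaussianPDF 0 1 * fun x => ENNReal.ofReal (Real.exp (x ^ 2 / 4))) x
        = ENNReal.ofReal ((Real.sqrt (2 * Real.pi))⁻¹ * Real.exp (-(1 / 4) * x ^ 2)) := by
      intro x
      rw [Pi.mul_apply, gaussianPDF, ← ENNReal.ofReal_mul (gaussianPDFReal_nonneg _ _ _),
        gaussianPDFReal]
      congr 1
      simp only [NNReal.coe_one, mul_one, sub_zero]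
      rw [mul_assoc, ← Real.exp_add]
      ring_nf
    simp_rw [hpt]
    rw [← ofReal_integral_eq_lintegral_ofReal
      ((integrable_exp_neg_mul_sq (by norm_num)).const_mul _)
      (ae_of_all _ fun _ => by positivity), integral_const_mul, integral_gaussian]
    congr 1
    rw [show Real.pi / (1 / 4) = 2 * (2 * Real.pi) by ring,
      Real.sqrt_mul zero_le_two (2 * Real.pi)]
    have : Real.sqrt (2 * Real.pi) ≠ 0 := by positivity
    rw [mul_comm, mul_assoc, mul_inv_cancel₀ this, mul_one]
  rw [← map_pi_eq_stdGaussian, lintegral_map (by fun_prop) (by fun_prop)]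
  have hpt : ∀ x : Fin m → ℝ, ENNReal.ofReal (Real.exp (‖WithLp.toLp 2 x‖ ^ 2 / 4))
      = ∏ i, ENNReal.ofReal (Real.exp (x i ^ 2 / 4)) := by
    intro x
    rw [← ENNReal.ofReal_prod_of_nonneg (fun _ _ => (Real.exp_pos _).le), ← Real.exp_sum,
      EuclideanSpace.norm_sq_eq, Finset.sum_div]
    simp
  simp_rw [hpt]
  have hind : iIndepFun (fun (i : Fin m) (x : Fin m → ℝ) =>
      ENNReal.ofReal (Real.exp (x i ^ 2 / 4))) (Measure.pi fun _ => gaussianReal 0 1) :=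
    iIndepFun_pi (X := fun _ x => ENNReal.ofReal (Real.exp (x ^ 2 / 4)))
      (fun _ => by fun_prop)
  rw [lintegral_prod_eq_prod_lintegral_of_indepFun Finset.univ _ hind (fun _ => by fun_prop)]
  have hi : ∀ i : Fin m, ∫⁻ x : Fin m → ℝ, ENNReal.ofReal (Real.exp (x i ^ 2 / 4))
      ∂(Measure.pi fun _ => gaussianReal 0 1) = ENNReal.ofReal (Real.sqrt 2) := by
    intro i
    rw [← hone]
    exact (measurePreserving_eval (fun _ : Fin m => gaussianReal 0 1) i).lintegral_comp
      (f := fun x => ENNReal.ofReal (Real.exp (x ^ 2 / 4))) (by fun_prop)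
  simp [hi, ENNReal.ofReal_pow (Real.sqrt_nonneg 2)]

end SingleIndex

/-! ### Gaussian concentration for Lipschitz functions -/

namespace SingleIndex

/-- Jensen's inequality for the exponential, with an extended-valued right-hand side. -/
lemma ofReal_exp_integral_le {α : Type*} [MeasurableSpace α] {ρ : Measure α}
    [IsProbabilityMeasure ρ] {φ : α → ℝ} (hφ : Integrable φ ρ) :
    ENNReal.ofReal (Real.exp (∫ x, φ x ∂ρ)) ≤ ∫⁻ x, ENNReal.ofReal (Real.exp (φ x)) ∂ρ := by
  by_cases htop : ∫⁻ x, ENNReal.ofReal (Real.exp (φ x)) ∂ρ = ⊤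
  · rw [htop]; exact le_top
  have hmeas : AEStronglyMeasurable (fun x => Real.exp (φ x)) ρ :=
    Real.continuous_exp.comp_aestronglyMeasurable hφ.aestronglyMeasurable
  have hint : Integrable (fun x => Real.exp (φ x)) ρ :=
    (lintegral_ofReal_ne_top_iff_integrable hmeas (ae_of_all _ fun _ => (Real.exp_pos _).le)).1 htop
  rw [← ofReal_integral_eq_lintegral_ofReal hint (ae_of_all _ fun _ => (Real.exp_pos _).le)]
  exact ENNReal.ofReal_le_ofReal (convexOn_exp.map_integral_le Real.continuous_exp.continuousOn
    isClosed_univ (ae_of_all _ fun _ => Set.mem_univ _) hφ hint)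

section Concentration

variable {E : Type*} [NormedAddCommGroup E] [InnerProductSpace ℝ E]

lemma hasDerivAt_rotation_fst (q : E × E) (θ : ℝ) :
    HasDerivAt (fun θ => (ContinuousLinearMap.rotation θ q).1)
      (ContinuousLinearMap.rotation θ q).2 θ := by
  simp only [ContinuousLinearMap.rotation_apply]
  exact ((Real.hasDerivAt_cos θ).smul_const q.1).add ((Real.hasDerivAt_sin θ).smul_const q.2)

lemma norm_rotation_snd_le (q : E × E) (θ : ℝ) :
    ‖(ContinuousLinearMap.rotation θ q).2‖ ≤ ‖q.1‖ + ‖q.2‖ := by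
  rw [ContinuousLinearMap.rotation_apply]
  refine (norm_add_le _ _).trans ?_
  rw [norm_smul, norm_smul, norm_neg]
  gcongr
  · exact mul_le_of_le_one_left (norm_nonneg _) (Real.abs_sin_le_one θ)
  · exact mul_le_of_le_one_left (norm_nonneg _) (Real.abs_cos_le_one θ)

lemma continuous_rotation :
    Continuous (fun p : ℝ × (E × E) => ContinuousLinearMap.rotation p.1 p.2) := by
  simp only [ContinuousLinearMap.rotation_apply]
  fun_prop

/-- The increment `F y - F x` is the integral of the derivative of `F` along the quarter circle
from `x` to `y`; Jensen's inequality moves the exponential inside this integral. -/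
lemma ofReal_exp_increment_le {F : E → ℝ} {k : NNReal} (hF : LipschitzWith k F) (s : ℝ) (q : E × E)
    (hq : ∀ᵐ θ ∂(volume[|Set.Ioc 0 (Real.pi / 2)]),
      DifferentiableAt ℝ F (ContinuousLinearMap.rotation θ q).1) :
    ENNReal.ofReal (Real.exp (s * (F q.2 - F q.1)))
      ≤ ∫⁻ θ, ENNReal.ofReal (Real.exp (s * (Real.pi / 2) *
          fderiv ℝ F (ContinuousLinearMap.rotation θ q).1 (ContinuousLinearMap.rotation θ q).2))
        ∂(volume[|Set.Ioc 0 (Real.pi / 2)]) := by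
  have hpi := Real.pi_pos
  have hvol : (volume : Measure ℝ) (Set.Ioc 0 (Real.pi / 2)) = ENNReal.ofReal (Real.pi / 2) := by
    simp
  have hprob : IsProbabilityMeasure (volume[|Set.Ioc 0 (Real.pi / 2)]) :=
    cond_isProbabilityMeasure_of_finite (by rw [hvol]; simp [hpi]) (by rw [hvol]; simp)
  set p : ℝ → E := fun θ => (ContinuousLinearMap.rotation θ q).1 with hp
  have hplip : LipschitzWith (Real.toNNReal (‖q.1‖ + ‖q.2‖)) p := by
    refine lipschitzWith_of_nnnorm_deriv_le
      (fun θ => (hasDerivAt_rotation_fst q θ).differentiableAt) fun θ => ?_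
    rw [(hasDerivAt_rotation_fst q θ).deriv, ← NNReal.coe_le_coe, coe_nnnorm,
      Real.coe_toNNReal _ (by positivity)]
    exact norm_rotation_snd_le q θ
  have hlip := hF.comp hplip
  have hbound : ∀ θ, ‖deriv (F ∘ p) θ‖ ≤ (k * Real.toNNReal (‖q.1‖ + ‖q.2‖) : NNReal) :=
    fun θ => norm_deriv_le_of_lipschitz hlip
  have hint : Integrable (fun θ => s * (Real.pi / 2) * deriv (F ∘ p) θ)
      (volume[|Set.Ioc 0 (Real.pi / 2)]) :=
    (Integrable.of_bound (measurable_deriv _).aestronglyMeasurable _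
      (ae_of_all _ hbound)).const_mul _
  have hftc := (hlip.lipschitzOnWith
    (s := Set.uIcc 0 (Real.pi / 2))).absolutelyContinuousOnInterval.integral_deriv_eq_sub
  have hval : ∫ θ, s * (Real.pi / 2) * deriv (F ∘ p) θ ∂(volume[|Set.Ioc 0 (Real.pi / 2)])
      = s * (F q.2 - F q.1) := by
    rw [integral_const_mul, ProbabilityTheory.cond, integral_smul_measure,
      ← intervalIntegral.integral_of_le (by positivity), hftc, hvol, ENNReal.toReal_inv,
      ENNReal.toReal_ofReal (by positivity)]
    simp only [hp, Function.comp_apply, ContinuousLinearMap.rotation_apply, Real.cos_pi_div_two,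
      Real.sin_pi_div_two, Real.cos_zero, Real.sin_zero, zero_smul, one_smul, zero_add, add_zero,
      smul_eq_mul]
    field_simp
  rw [← hval]
  refine (ofReal_exp_integral_le hint).trans (lintegral_mono_ae ?_)
  filter_upwards [hq] with θ hθ
  rw [(hθ.hasFDerivAt.comp_hasDerivAt θ (hasDerivAt_rotation_fst q θ)).deriv]

variable [FiniteDimensional ℝ E] [MeasurableSpace E] [BorelSpace E]

/-- Rotation argument for pairs: if `F` is `k`-Lipschitz and `x`, `y` are independent standard
Gaussian vectors, then `F y - F x` is subgaussian. Along the quarter circle, position and velocity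
are again independent standard Gaussian vectors, so the derivative of `F` in direction of the
velocity is conditionally Gaussian with standard deviation at most `k`. -/
lemma lintegral_exp_increment_le {F : E → ℝ} {k : NNReal} (hF : LipschitzWith k F) (s : ℝ) :
    ∫⁻ q, ENNReal.ofReal (Real.exp (s * (F q.2 - F q.1)))
        ∂((stdGaussian E).prod (stdGaussian E))
      ≤ ENNReal.ofReal (Real.exp (Real.pi ^ 2 / 8 * (s * k) ^ 2)) := by
  have hpi := Real.pi_pos
  have hvol : (volume : Measure ℝ) (Set.Ioc 0 (Real.pi / 2)) = ENNReal.ofReal (Real.pi / 2) := by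
    simp
  have hprob : IsProbabilityMeasure (volume[|Set.Ioc 0 (Real.pi / 2)]) :=
    cond_isProbabilityMeasure_of_finite (by rw [hvol]; simp [hpi]) (by rw [hvol]; simp)
  set H : E × E → ENNReal := fun q =>
    ENNReal.ofReal (Real.exp (s * (Real.pi / 2) * fderiv ℝ F q.1 q.2)) with hH
  have hHm : Measurable H := by
    have h1 : Measurable (fun q : E × E => fderiv ℝ F q.1 q.2) :=
      (isBoundedBilinearMap_apply (𝕜 := ℝ) (E := E) (F := ℝ)).continuous.measurable.comp
        (((measurable_fderiv ℝ F).comp measurable_fst).prodMk measurable_snd)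
    exact ((h1.const_mul _).exp).ennreal_ofReal
  have hrotm := (continuous_rotation (E := E)).measurable
  have hrot : ∀ θ, ((stdGaussian E).prod (stdGaussian E)).map (ContinuousLinearMap.rotation θ)
      = (stdGaussian E).prod (stdGaussian E) := fun θ =>
    IsGaussian.map_rotation_eq_self (by simp) θ
  have hD : MeasurableSet {x | DifferentiableAt ℝ F x} := measurableSet_of_differentiableAt ℝ F
  have hae : ∀ᵐ q ∂((stdGaussian E).prod (stdGaussian E)),
      ∀ᵐ θ ∂(volume[|Set.Ioc 0 (Real.pi / 2)]),
      DifferentiableAt ℝ F (ContinuousLinearMap.rotation θ q).1 := by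
    rw [Measure.ae_ae_comm]
    · refine ae_of_all _ fun θ => ?_
      have h1 : ∀ᵐ x ∂(stdGaussian E), DifferentiableAt ℝ F x :=
        stdGaussian_absolutelyContinuous.ae_le hF.ae_differentiableAt
      have h2 : ∀ᵐ q ∂((stdGaussian E).prod (stdGaussian E)), DifferentiableAt ℝ F q.1 :=
        Measure.quasiMeasurePreserving_fst.ae h1
      rw [← hrot θ] at h2
      exact ae_of_ae_map (f := ContinuousLinearMap.rotation θ) (by fun_prop) h2
    · exact measurable_fst.comp (hrotm.comp measurable_swap) hD
  calc ∫⁻ q, ENNReal.ofReal (Real.exp (s * (F q.2 - F q.1)))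
        ∂((stdGaussian E).prod (stdGaussian E))
      ≤ ∫⁻ q, ∫⁻ θ, H (ContinuousLinearMap.rotation θ q) ∂(volume[|Set.Ioc 0 (Real.pi / 2)])
          ∂((stdGaussian E).prod (stdGaussian E)) := by
        refine lintegral_mono_ae ?_
        filter_upwards [hae] with q hq using ofReal_exp_increment_le hF s q hq
    _ = ∫⁻ θ, ∫⁻ q, H (ContinuousLinearMap.rotation θ q)
          ∂((stdGaussian E).prod (stdGaussian E)) ∂(volume[|Set.Ioc 0 (Real.pi / 2)]) :=
        lintegral_lintegral_swap (hHm.comp (hrotm.comp measurable_swap)).aemeasurable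
    _ = ∫⁻ _, ∫⁻ q, H q ∂((stdGaussian E).prod (stdGaussian E))
          ∂(volume[|Set.Ioc 0 (Real.pi / 2)]) := by
        refine lintegral_congr fun θ => ?_
        conv_rhs => rw [← hrot θ]
        rw [lintegral_map hHm (by fun_prop)]
    _ = ∫⁻ q, H q ∂((stdGaussian E).prod (stdGaussian E)) := by simp
    _ = ∫⁻ x, ∫⁻ y, H (x, y) ∂(stdGaussian E) ∂(stdGaussian E) :=
        lintegral_prod _ hHm.aemeasurable
    _ ≤ ∫⁻ _, ENNReal.ofReal (Real.exp (Real.pi ^ 2 / 8 * (s * k) ^ 2)) ∂(stdGaussian E) := by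
        refine lintegral_mono fun x => ?_
        have h := lintegral_exp_dual_stdGaussian ((s * (Real.pi / 2)) • fderiv ℝ F x)
        simp only [FunLike.coe_smul, Pi.smul_apply, smul_eq_mul] at h
        simp only [hH]
        rw [h]
        refine ENNReal.ofReal_le_ofReal (Real.exp_le_exp.2 ?_)
        have h1 : ‖fderiv ℝ F x‖ ^ 2 ≤ (k : ℝ) ^ 2 :=
          pow_le_pow_left₀ (norm_nonneg _) (norm_fderiv_le_of_lipschitz ℝ hF) 2
        rw [norm_smul, mul_pow, Real.norm_eq_abs, sq_abs]
        have h2 : 0 ≤ (s * (Real.pi / 2)) ^ 2 := sq_nonneg _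
        nlinarith
    _ = _ := by simp

lemma integrable_of_lipschitzWith_stdGaussian {F : E → ℝ} {k : NNReal} (hF : LipschitzWith k F) :
    Integrable F (stdGaussian E) := by
  have h1 : Integrable (fun x : E => |F 0| + k * ‖x‖) (stdGaussian E) :=
    (integrable_const _).add ((IsGaussian.integrable_id (μ := stdGaussian E)).norm.const_mul _)
  refine h1.mono' hF.continuous.aestronglyMeasurable (ae_of_all _ fun x => ?_)
  have h := hF.norm_sub_le x 0
  rw [sub_zero] at h
  have := norm_sub_norm_le (F x) (F 0)
  rw [Real.norm_eq_abs (F 0)] at this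
  linarith

/-- Gaussian concentration in exponential form, with the constant `π² / 8`. -/
lemma lintegral_exp_lipschitz_stdGaussian_le {F : E → ℝ} {k : NNReal} (hF : LipschitzWith k F)
    (s : ℝ) :
    ∫⁻ x, ENNReal.ofReal (Real.exp (s * F x)) ∂(stdGaussian E)
      ≤ ENNReal.ofReal (Real.exp (s * ∫ x, F x ∂(stdGaussian E)
          + Real.pi ^ 2 / 8 * (s * k) ^ 2)) := by
  have hFi := integrable_of_lipschitzWith_stdGaussian hF
  have hFc := hF.continuous.measurable
  set w := ∫ x, F x ∂(stdGaussian E) with hw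
  have h1 : ∀ y, ENNReal.ofReal (Real.exp (s * F y))
      ≤ ENNReal.ofReal (Real.exp (s * w)) *
        ∫⁻ x, ENNReal.ofReal (Real.exp (s * (F y - F x))) ∂(stdGaussian E) := by
    intro y
    have hi : Integrable (fun x => s * (F y - F x)) (stdGaussian E) :=
      ((integrable_const _).sub hFi).const_mul s
    have hv : ∫ x, s * (F y - F x) ∂(stdGaussian E) = s * F y - s * w := by
      rw [integral_const_mul, integral_sub (integrable_const _) hFi]
      simp [hw, mul_sub]
    have h := ofReal_exp_integral_le hi
    rw [hv] at h
    calc ENNReal.ofReal (Real.exp (s * F y))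
        = ENNReal.ofReal (Real.exp (s * w)) * ENNReal.ofReal (Real.exp (s * F y - s * w)) := by
          rw [← ENNReal.ofReal_mul (Real.exp_pos _).le, ← Real.exp_add]; ring_nf
      _ ≤ _ := by gcongr
  calc ∫⁻ y, ENNReal.ofReal (Real.exp (s * F y)) ∂(stdGaussian E)
      ≤ ∫⁻ y, ENNReal.ofReal (Real.exp (s * w)) *
        ∫⁻ x, ENNReal.ofReal (Real.exp (s * (F y - F x))) ∂(stdGaussian E) ∂(stdGaussian E) :=
        lintegral_mono h1
    _ = ENNReal.ofReal (Real.exp (s * w)) *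
        ∫⁻ y, ∫⁻ x, ENNReal.ofReal (Real.exp (s * (F y - F x))) ∂(stdGaussian E)
          ∂(stdGaussian E) := lintegral_const_mul' _ _ ENNReal.ofReal_ne_top
    _ = ENNReal.ofReal (Real.exp (s * w)) *
        ∫⁻ q, ENNReal.ofReal (Real.exp (s * (F q.2 - F q.1)))
          ∂((stdGaussian E).prod (stdGaussian E)) := by
        rw [lintegral_prod_symm' _ (by fun_prop)]
    _ ≤ ENNReal.ofReal (Real.exp (s * w)) *
        ENNReal.ofReal (Real.exp (Real.pi ^ 2 / 8 * (s * k) ^ 2)) := by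
        gcongr
        exact lintegral_exp_increment_le hF s
    _ = _ := by rw [← ENNReal.ofReal_mul (Real.exp_pos _).le, ← Real.exp_add]

end Concentration

end SingleIndex

/-! ### The support function of a bounded set -/

namespace SingleIndex

section Support

variable {E : Type*} [NormedAddCommGroup E] [InnerProductSpace ℝ E]

/-- The support function `g ↦ sup_{h ∈ T} ⟨g, h⟩` of `T` (used for nonempty bounded `T`). -/
noncomputable def supportFun (T : Set E) (g : E) : ℝ := ⨆ h : T, ⟪g, (h : E)⟫_ℝ

variable {T : Set E} {t : ℝ}

lemma bddAbove_range_inner (hT : ∀ h ∈ T, ‖h‖ ≤ t) (g : E) :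
    BddAbove (Set.range fun h : T => ⟪g, (h : E)⟫_ℝ) := by
  refine ⟨‖g‖ * t, ?_⟩
  rintro _ ⟨h, rfl⟩
  exact (real_inner_le_norm _ _).trans (mul_le_mul_of_nonneg_left (hT h h.2) (norm_nonneg _))

lemma inner_le_supportFun (hT : ∀ h ∈ T, ‖h‖ ≤ t) (g : E) {h : E} (hh : h ∈ T) :
    ⟪g, h⟫_ℝ ≤ supportFun T g :=
  le_ciSup (bddAbove_range_inner hT g) ⟨h, hh⟩

lemma supportFun_nonneg (hT : ∀ h ∈ T, ‖h‖ ≤ t) (h0 : (0 : E) ∈ T) (g : E) :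
    0 ≤ supportFun T g := by
  simpa using inner_le_supportFun hT g h0

lemma supportFun_add_le (hT : ∀ h ∈ T, ‖h‖ ≤ t) (h0 : (0 : E) ∈ T) (g g' : E) :
    supportFun T (g + g') ≤ supportFun T g + supportFun T g' := by
  have : Nonempty T := ⟨⟨0, h0⟩⟩
  refine ciSup_le fun h => ?_
  rw [inner_add_left]
  exact add_le_add (inner_le_supportFun hT g h.2) (inner_le_supportFun hT g' h.2)

lemma supportFun_smul {c : ℝ} (hc : 0 ≤ c) (T : Set E) (g : E) :
    supportFun T (c • g) = c * supportFun T g := by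
  rw [supportFun, supportFun, Real.mul_iSup_of_nonneg hc]
  simp only [real_inner_smul_left]

lemma lipschitzWith_supportFun (hT : ∀ h ∈ T, ‖h‖ ≤ t) (h0 : (0 : E) ∈ T) :
    LipschitzWith t.toNNReal (supportFun T) := by
  have ht : 0 ≤ t := (norm_nonneg _).trans (hT 0 h0)
  refine LipschitzWith.of_le_add_mul _ fun g g' => ?_
  have : Nonempty T := ⟨⟨0, h0⟩⟩
  refine ciSup_le fun h => ?_
  have h1 : ⟪g, (h : E)⟫_ℝ = ⟪g', (h : E)⟫_ℝ + ⟪g - g', (h : E)⟫_ℝ := by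
    rw [inner_sub_left]; ring
  rw [h1, Real.coe_toNNReal t ht, dist_eq_norm, mul_comm]
  exact add_le_add (inner_le_supportFun hT g' h.2) ((real_inner_le_norm _ _).trans
    (mul_le_mul_of_nonneg_left (hT h h.2) (norm_nonneg _)))

lemma measurable_supportFun [MeasurableSpace E] [BorelSpace E] (hT : ∀ h ∈ T, ‖h‖ ≤ t) (h0 : (0 : E) ∈ T) :
    Measurable (supportFun T) :=
  (lipschitzWith_supportFun hT h0).continuous.measurable

variable [FiniteDimensional ℝ E] [MeasurableSpace E] [BorelSpace E]

lemma integrable_supportFun (hT : ∀ h ∈ T, ‖h‖ ≤ t) (h0 : (0 : E) ∈ T) :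
    Integrable (supportFun T) (stdGaussian E) :=
  integrable_of_lipschitzWith_stdGaussian (lipschitzWith_supportFun hT h0)

/-- Deleting the component of a Gaussian vector along `x₀` does not increase the mean width: the
projected vector is the midpoint of `g` and its mirror image, which has the law of `g`. -/
lemma lintegral_supportFun_orthogonal_le (hT : ∀ h ∈ T, ‖h‖ ≤ t) (h0 : (0 : E) ∈ T) {x₀ : E}
    (hx₀ : ‖x₀‖ = 1) :
    ∫⁻ g, ENNReal.ofReal (supportFun T (g - ⟪x₀, g⟫_ℝ • x₀)) ∂(stdGaussian E)
      ≤ ENNReal.ofReal (∫ g, supportFun T g ∂(stdGaussian E)) := by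
  have hm := measurable_supportFun hT h0
  have hR : Measurable fun g : E => g - (2 * ⟪x₀, g⟫_ℝ) • x₀ := by fun_prop
  rw [ofReal_integral_eq_lintegral_ofReal (integrable_supportFun hT h0)
    (ae_of_all _ (supportFun_nonneg hT h0))]
  have hpt : ∀ g : E, ENNReal.ofReal (supportFun T (g - ⟪x₀, g⟫_ℝ • x₀))
      ≤ ENNReal.ofReal (1 / 2) * ENNReal.ofReal (supportFun T g)
        + ENNReal.ofReal (1 / 2) * ENNReal.ofReal (supportFun T (g - (2 * ⟪x₀, g⟫_ℝ) • x₀)) := by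
    intro g
    have hmid : g - ⟪x₀, g⟫_ℝ • x₀
        = (1 / 2 : ℝ) • g + (1 / 2 : ℝ) • (g - (2 * ⟪x₀, g⟫_ℝ) • x₀) := by
      module
    have h1 := supportFun_nonneg hT h0 g
    have h2 := supportFun_nonneg hT h0 (g - (2 * ⟪x₀, g⟫_ℝ) • x₀)
    rw [← ENNReal.ofReal_mul (by norm_num), ← ENNReal.ofReal_mul (by norm_num),
      ← ENNReal.ofReal_add (by positivity) (by positivity)]
    refine ENNReal.ofReal_le_ofReal ?_
    rw [hmid, ← supportFun_smul (by norm_num), ← supportFun_smul (by norm_num)]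
    exact supportFun_add_le hT h0 _ _
  have hrefl : ∫⁻ g, ENNReal.ofReal (supportFun T (g - (2 * ⟪x₀, g⟫_ℝ) • x₀)) ∂(stdGaussian E)
      = ∫⁻ g, ENNReal.ofReal (supportFun T g) ∂(stdGaussian E) := by
    conv_rhs => rw [← map_reflection_stdGaussian hx₀]
    rw [lintegral_map hm.ennreal_ofReal hR]
  refine (lintegral_mono hpt).trans_eq ?_
  rw [lintegral_add_left (by fun_prop), lintegral_const_mul _ (by fun_prop),
    lintegral_const_mul _ (by fun_prop), hrefl, ← add_mul,
    ← ENNReal.ofReal_add (by norm_num) (by norm_num)]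
  norm_num

end Support

/-! ### Uniform bounds for a Gaussian matrix -/

section Matrix

variable {E : Type*} [NormedAddCommGroup E] [InnerProductSpace ℝ E] {T : Set E} {t : ℝ}

/-- The exponential moment `E_γ exp(l · sup_{h ∈ T} ∑ᵢ γᵢ ⟨aᵢ, h⟩)` over a standard Gaussian
vector `γ`, as a function of the rows `aᵢ`. -/
noncomputable def gaussianMix {m : ℕ} (T : Set E) (l : ℝ) (a : Fin m → E) : ENNReal :=
  ∫⁻ γ, ENNReal.ofReal (Real.exp (l * supportFun T (∑ i, γ i • a i)))
    ∂(stdGaussian (EuclideanSpace ℝ (Fin m)))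

/-- Linearization of the squared norm: for fixed `h`, `exp(l² ‖(⟨aᵢ, h⟩)ᵢ‖² / 2)` is a Gaussian
exponential moment, whose integrand is bounded by a supremum over `h`. -/
lemma exp_sum_inner_sq_le_gaussianMix (hT : ∀ h ∈ T, ‖h‖ ≤ t) {m : ℕ} {l : ℝ} (hl : 0 ≤ l)
    (a : Fin m → E) {h : E} (hh : h ∈ T) :
    ENNReal.ofReal (Real.exp (l ^ 2 * (∑ i, ⟪a i, h⟫_ℝ ^ 2) / 2)) ≤ gaussianMix T l a := by
  set v : EuclideanSpace ℝ (Fin m) := l • WithLp.toLp 2 fun i => ⟪a i, h⟫_ℝ with hv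
  have h1 : ‖v‖ ^ 2 = l ^ 2 * ∑ i, ⟪a i, h⟫_ℝ ^ 2 := by
    rw [hv, norm_smul, mul_pow, EuclideanSpace.norm_sq_eq]
    simp
  rw [← h1, ← lintegral_exp_inner_stdGaussian]
  refine lintegral_mono fun γ => ENNReal.ofReal_le_ofReal (Real.exp_le_exp.2 ?_)
  have h2 : ⟪γ, v⟫_ℝ = l * ⟪∑ i, γ i • a i, h⟫_ℝ := by
    rw [hv, real_inner_smul_right, PiLp.inner_apply, sum_inner]
    simp [real_inner_smul_left, mul_comm]
  rw [h2]
  exact mul_le_mul_of_nonneg_left (inner_le_supportFun hT _ hh) hl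

/-- On the event that the mixed exponential moment is at most `exp m / e`, the Gaussian matrix is
bounded on `T`, uniformly in `h`. -/
lemma sum_inner_sq_le_of_gaussianMix_le (hT : ∀ h ∈ T, ‖h‖ ≤ t) (ht : 0 < t) {m : ℕ} (hm : 0 < m)
    {e : ℝ} (he : 0 < e) (he1 : e ≤ 1) {a : Fin m → E}
    (ha : gaussianMix T (1 / (4 * t)) a ≤ ENNReal.ofReal (Real.exp m) / ENNReal.ofReal e)
    {h : E} (hh : h ∈ T) :
    ∑ i, ⟪a i, h⟫_ℝ ^ 2 ≤ 32 * (1 + Real.log (1 / e)) * t ^ 2 * m := by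
  have h1 := (exp_sum_inner_sq_le_gaussianMix hT (l := 1 / (4 * t)) (by positivity) a hh).trans ha
  rw [← ENNReal.ofReal_div_of_pos he, ENNReal.ofReal_le_ofReal_iff (by positivity)] at h1
  have h2 : Real.exp m / e = Real.exp (m + Real.log (1 / e)) := by
    rw [Real.exp_add, Real.exp_log (by positivity)]; ring
  rw [h2, Real.exp_le_exp] at h1
  have hm1 : (1 : ℝ) ≤ m := by exact_mod_cast hm
  have hlog : 0 ≤ Real.log (1 / e) := Real.log_nonneg (by rw [le_div_iff₀ he]; linarith)
  have h3 : (1 / (4 * t)) ^ 2 * (∑ i, ⟪a i, h⟫_ℝ ^ 2) / 2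
      = (∑ i, ⟪a i, h⟫_ℝ ^ 2) / (32 * t ^ 2) := by
    field_simp; ring
  rw [h3, div_le_iff₀ (by positivity)] at h1
  have h4 : (m : ℝ) + Real.log (1 / e) ≤ (1 + Real.log (1 / e)) * m := by nlinarith
  calc _ ≤ _ := h1
    _ ≤ ((1 + Real.log (1 / e)) * m) * (32 * t ^ 2) := by gcongr
    _ = _ := by ring

variable [FiniteDimensional ℝ E] [MeasurableSpace E] [BorelSpace E]

lemma measurable_gaussianMix_integrand (hT : ∀ h ∈ T, ‖h‖ ≤ t) (h0 : (0 : E) ∈ T) (m : ℕ) (l : ℝ) :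
    Measurable fun p : (Fin m → E) × EuclideanSpace ℝ (Fin m) =>
      ENNReal.ofReal (Real.exp (l * supportFun T (∑ i, p.2 i • p.1 i))) := by
  have hm := measurable_supportFun hT h0
  have h1 : Measurable fun p : (Fin m → E) × EuclideanSpace ℝ (Fin m) => ∑ i, p.2 i • p.1 i :=
    Finset.measurable_sum _ fun i _ => by fun_prop
  exact (((hm.comp h1).const_mul l).exp).ennreal_ofReal

lemma measurable_gaussianMix (hT : ∀ h ∈ T, ‖h‖ ≤ t) (h0 : (0 : E) ∈ T) (m : ℕ) (l : ℝ) :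
    Measurable (gaussianMix (m := m) T l) :=
  (measurable_gaussianMix_integrand hT h0 m l).lintegral_prod_right'

/-- For a Gaussian matrix with rows `aᵢ` the vector `∑ᵢ γᵢ aᵢ` is distributed as `‖γ‖ g`, so
Gaussian concentration bounds the mixed exponential moment at the scale `l = 1 / (4 t)`. -/
lemma lintegral_gaussianMix_le (hT : ∀ h ∈ T, ‖h‖ ≤ t) (h0 : (0 : E) ∈ T) (ht : 0 < t) {m : ℕ}
    (hw : ∫ g, supportFun T g ∂(stdGaussian E) ≤ t * Real.sqrt m) :
    ∫⁻ a, gaussianMix T (1 / (4 * t)) a ∂(Measure.pi fun _ : Fin m => stdGaussian E)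
      ≤ ENNReal.ofReal (Real.exp m) := by
  set w := ∫ g, supportFun T g ∂(stdGaussian E) with hwdef
  set l : ℝ := 1 / (4 * t) with hl
  have hl0 : 0 < l := by positivity
  have hm := measurable_supportFun hT h0
  have hlip := lipschitzWith_supportFun hT h0
  have hinner : ∀ γ : EuclideanSpace ℝ (Fin m),
      ∫⁻ a, ENNReal.ofReal (Real.exp (l * supportFun T (∑ i, γ i • a i)))
        ∂(Measure.pi fun _ : Fin m => stdGaussian E)
      ≤ ENNReal.ofReal (Real.exp (m / 8)) * ENNReal.ofReal (Real.exp (‖γ‖ ^ 2 / 4)) := by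
    intro γ
    have hG : Measurable fun x : E => ENNReal.ofReal (Real.exp (l * supportFun T x)) :=
      ((hm.const_mul l).exp).ennreal_ofReal
    have hsq : Real.sqrt (∑ i, γ i ^ 2) = ‖γ‖ := by
      rw [EuclideanSpace.norm_eq]; simp
    have h1 : ∫⁻ a, ENNReal.ofReal (Real.exp (l * supportFun T (∑ i, γ i • a i)))
        ∂(Measure.pi fun _ : Fin m => stdGaussian E)
        = ∫⁻ x, ENNReal.ofReal (Real.exp ((l * ‖γ‖) * supportFun T x)) ∂(stdGaussian E) := by
      rw [← lintegral_map (g := fun a : Fin m → E => ∑ i, γ i • a i) hG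
          (Finset.measurable_sum _ fun i _ => by fun_prop),
        map_sum_smul_stdGaussian, lintegral_map hG (by fun_prop), hsq]
      simp only [supportFun_smul (norm_nonneg γ), mul_assoc]
    rw [h1, ← ENNReal.ofReal_mul (Real.exp_pos _).le, ← Real.exp_add]
    refine (lintegral_exp_lipschitz_stdGaussian_le hlip (l * ‖γ‖)).trans
      (ENNReal.ofReal_le_ofReal (Real.exp_le_exp.2 ?_))
    rw [Real.coe_toNNReal t ht.le]
    have hlt : l * t = 1 / 4 := by rw [hl]; field_simp
    have e1 : l * ‖γ‖ * w ≤ (‖γ‖ ^ 2 + m) / 8 := by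
      have h2 : l * ‖γ‖ * w ≤ l * ‖γ‖ * (t * Real.sqrt m) := by gcongr
      have h3 : l * ‖γ‖ * (t * Real.sqrt m) = 1 / 4 * (‖γ‖ * Real.sqrt m) := by
        rw [← hlt]; ring
      have h4 := two_mul_le_add_sq ‖γ‖ (Real.sqrt m)
      rw [Real.sq_sqrt (Nat.cast_nonneg m)] at h4
      linarith
    have e2 : Real.pi ^ 2 / 8 * (l * ‖γ‖ * t) ^ 2 ≤ ‖γ‖ ^ 2 / 8 := by
      have h2 : l * ‖γ‖ * t = 1 / 4 * ‖γ‖ := by rw [← hlt]; ring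
      have h3 : Real.pi ^ 2 ≤ 4 ^ 2 := pow_le_pow_left₀ Real.pi_pos.le Real.pi_le_four 2
      rw [h2]
      nlinarith [sq_nonneg ‖γ‖]
    linarith
  calc ∫⁻ a, gaussianMix T l a ∂(Measure.pi fun _ : Fin m => stdGaussian E)
      = ∫⁻ γ, ∫⁻ a, ENNReal.ofReal (Real.exp (l * supportFun T (∑ i, γ i • a i)))
          ∂(Measure.pi fun _ : Fin m => stdGaussian E)
          ∂(stdGaussian (EuclideanSpace ℝ (Fin m))) :=
        lintegral_lintegral_swap (measurable_gaussianMix_integrand hT h0 m l).aemeasurable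
    _ ≤ ∫⁻ γ, ENNReal.ofReal (Real.exp (m / 8)) * ENNReal.ofReal (Real.exp (‖γ‖ ^ 2 / 4))
          ∂(stdGaussian (EuclideanSpace ℝ (Fin m))) := lintegral_mono hinner
    _ = ENNReal.ofReal (Real.exp (m / 8) * Real.sqrt 2 ^ m) := by
        rw [lintegral_const_mul _ (by fun_prop), lintegral_exp_norm_sq_stdGaussian,
          ENNReal.ofReal_mul (Real.exp_pos _).le]
    _ ≤ ENNReal.ofReal (Real.exp m) := by
        refine ENNReal.ofReal_le_ofReal ?_
        have h1 : Real.sqrt 2 ≤ Real.exp (7 / 8) := by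
          have h2 : Real.sqrt 2 ≤ 3 / 2 := Real.sqrt_le_iff.2 (by norm_num)
          have h3 := Real.add_one_le_exp (7 / 8 : ℝ)
          linarith
        calc Real.exp (m / 8) * Real.sqrt 2 ^ m
            ≤ Real.exp (m / 8) * Real.exp (7 / 8) ^ m := by gcongr
          _ = Real.exp m := by
            rw [← Real.exp_nat_mul, ← Real.exp_add]; ring_nf

end Matrix

end SingleIndex

/-! ### The gradient noise on product space -/

namespace SingleIndex

/-- Markov's inequality at level `M / e`, including the case `M = 0`. -/
lemma measure_lt_le_of_lintegral_le {α : Type*} [MeasurableSpace α] {ρ : Measure α}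
    {φ : α → ENNReal} (hφ : AEMeasurable φ ρ) {M : ENNReal} (hM : M ≠ ⊤)
    (hle : ∫⁻ x, φ x ∂ρ ≤ M) {e : ℝ} (he : 0 < e) :
    ρ {x | M / ENNReal.ofReal e < φ x} ≤ ENNReal.ofReal e := by
  have he0 : ENNReal.ofReal e ≠ 0 := by simpa using he
  rcases eq_or_ne M 0 with rfl | hM0
  · have h0 : φ =ᵐ[ρ] 0 := (lintegral_eq_zero_iff' hφ).1 (le_antisymm hle zero_le)
    have : ρ {x | 0 / ENNReal.ofReal e < φ x} = 0 := by
      refine measure_mono_null (fun x hx => ?_) (ae_iff.1 h0)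
      simp only [ENNReal.zero_div, Set.mem_ofPred_eq] at hx
      exact hx.ne'
    rw [this]; exact zero_le
  · have h1 : M / ENNReal.ofReal e ≠ 0 := ENNReal.div_ne_zero.2 ⟨hM0, ENNReal.ofReal_ne_top⟩
    have h2 : M / ENNReal.ofReal e ≠ ⊤ := ENNReal.div_ne_top hM he0
    calc ρ {x | M / ENNReal.ofReal e < φ x} ≤ ρ {x | M / ENNReal.ofReal e ≤ φ x} :=
          measure_mono fun x (hx : _ < φ x) => hx.le
      _ ≤ (∫⁻ x, φ x ∂ρ) / (M / ENNReal.ofReal e) := meas_ge_le_lintegral_div hφ h1 h2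
      _ ≤ M / (M / ENNReal.ofReal e) := by gcongr
      _ = ENNReal.ofReal e := ENNReal.div_div_cancel hM0 hM

section Noise

variable {E S : Type*} [NormedAddCommGroup E] [InnerProductSpace ℝ E] [FiniteDimensional ℝ E]
  [MeasurableSpace E] [BorelSpace E] [MeasurableSpace S] {ν : Measure S} [IsProbabilityMeasure ν]
  {x₀ : E}

instance : IsProbabilityMeasure (refLaw ν) := by unfold refLaw; infer_instance

/-- The pair `(⟨a, x₀⟩, s)` on which the clean residual of the measurement `(a, s)` depends. -/
def indexPair (x₀ : E) (q : E × S) : ℝ × S := (⟪x₀, q.1⟫_ℝ, q.2)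

lemma measurable_indexPair (x₀ : E) : Measurable (indexPair (S := S) x₀) := by
  unfold indexPair; fun_prop

lemma map_indexPair (hx₀ : ‖x₀‖ = 1) :
    ((stdGaussian E).prod ν).map (indexPair x₀) = refLaw ν := by
  have h1 : (stdGaussian E).map (fun a => ⟪x₀, a⟫_ℝ) = gaussianReal 0 1 := by
    have h := IsGaussian.map_eq_gaussianReal (μ := stdGaussian E) (innerSL ℝ x₀)
    rw [integral_strongDual_stdGaussian, variance_dual_stdGaussian, innerSL_apply_norm, hx₀] at h
    simpa [innerSL_apply_apply] using h
  rw [refLaw, ← h1]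
  conv_rhs => rw [← Measure.map_id (μ := ν)]
  rw [Measure.map_prod_map _ _ (by fun_prop) measurable_id]
  rfl

/-- Replacing the components of the measurement vectors orthogonal to `x₀` by independent copies
does not change the law of the sample. -/
lemma lintegral_splice_pi (hx₀ : ‖x₀‖ = 1) {m : ℕ} {Φ : (Fin m → E × S) → ENNReal}
    (hΦ : Measurable Φ) :
    ∫⁻ q, Φ q ∂(Measure.pi fun _ : Fin m => (stdGaussian E).prod ν)
      = ∫⁻ q, ∫⁻ b, Φ (fun i => (spliceAlong x₀ ((q i).1, b i), (q i).2))
          ∂(Measure.pi fun _ : Fin m => stdGaussian E)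
          ∂(Measure.pi fun _ : Fin m => (stdGaussian E).prod ν) := by
  set ρ := (stdGaussian E).prod ν with hρ
  let Ψ : (E × S) × E → E × S := fun r => (spliceAlong x₀ (r.1.1, r.2), r.1.2)
  have hΨ : Measurable Ψ :=
    ((measurable_spliceAlong x₀).comp (by fun_prop)).prodMk (by fun_prop)
  have hmap : (ρ.prod (stdGaussian E)).map Ψ = ρ := by
    have e1 := measurePreserving_prodAssoc (stdGaussian E) ν (stdGaussian E)
    have e2 := (MeasurePreserving.id (stdGaussian E)).prod
      (Measure.measurePreserving_swap (μ := ν) (ν := stdGaussian E))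
    have e3 := (measurePreserving_prodAssoc (stdGaussian E) (stdGaussian E) ν).symm
    have e4 := (show MeasurePreserving (spliceAlong x₀) ((stdGaussian E).prod (stdGaussian E))
      (stdGaussian E) from ⟨measurable_spliceAlong x₀, map_spliceAlong_stdGaussian hx₀⟩).prod
        (MeasurePreserving.id ν)
    exact (e4.comp (e3.comp (e2.comp e1))).map_eq
  have h1 : Measure.pi (fun _ : Fin m => ρ)
      = (Measure.pi fun _ : Fin m => ρ.prod (stdGaussian E)).map (fun r i => Ψ (r i)) := by
    rw [Measure.pi_map_pi (fun _ => hΨ.aemeasurable)]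
    simp_rw [hmap]
  have hΨm : Measurable fun (r : Fin m → (E × S) × E) i => Ψ (r i) :=
    measurable_pi_lambda _ fun i => hΨ.comp (measurable_pi_apply i)
  have h2 := (measurePreserving_arrowProdEquivProdArrow (E × S) E (Fin m)
    (fun _ => ρ) (fun _ => stdGaussian E)).symm
  conv_lhs => rw [h1]
  rw [lintegral_map hΦ hΨm, ← h2.map_eq,
    lintegral_map (f := fun r : Fin m → (E × S) × E => Φ fun i => Ψ (r i)) (hΦ.comp hΨm)
      (MeasurableEquiv.measurable _)]
  exact lintegral_prod _ ((hΦ.comp hΨm).comp (MeasurableEquiv.measurable _)).aemeasurable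

variable {φ : ℝ × S → ℝ} {m : ℕ}

lemma integrable_comp_eval_indexPair (hx₀ : ‖x₀‖ = 1) {ψ : ℝ × S → ℝ}
    (hψ : Integrable ψ (refLaw ν)) (i : Fin m) :
    Integrable (fun q : Fin m → E × S => ψ (indexPair x₀ (q i)))
      (Measure.pi fun _ => (stdGaussian E).prod ν) := by
  have h1 : MeasurePreserving (indexPair x₀) ((stdGaussian E).prod ν) (refLaw ν) :=
    ⟨measurable_indexPair x₀, map_indexPair hx₀⟩
  have h2 := h1.comp (measurePreserving_eval (fun _ : Fin m => (stdGaussian E).prod ν) i)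
  exact h2.integrable_comp_of_integrable hψ

lemma integral_comp_eval_indexPair (hx₀ : ‖x₀‖ = 1) {ψ : ℝ × S → ℝ}
    (hψ : AEStronglyMeasurable ψ (refLaw ν)) (i : Fin m) :
    ∫ q : Fin m → E × S, ψ (indexPair x₀ (q i)) ∂(Measure.pi fun _ => (stdGaussian E).prod ν)
      = ∫ p, ψ p ∂(refLaw ν) := by
  have h1 : MeasurePreserving (indexPair x₀) ((stdGaussian E).prod ν) (refLaw ν) :=
    ⟨measurable_indexPair x₀, map_indexPair hx₀⟩
  have h2 := h1.comp (measurePreserving_eval (fun _ : Fin m => (stdGaussian E).prod ν) i)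
  have h3 := integral_map (μ := Measure.pi fun _ : Fin m => (stdGaussian E).prod ν)
    h2.measurable.aemeasurable (f := ψ) (by rwa [h2.map_eq])
  rw [h2.map_eq] at h3
  exact h3.symm

/-- The expected Euclidean norm of the residual vector is at most the root of its second moment. -/
lemma lintegral_norm_residual_le (hx₀ : ‖x₀‖ = 1) (hφ : Measurable φ)
    (hφ2 : Integrable (fun p => φ p ^ 2) (refLaw ν)) :
    ∫⁻ q, ENNReal.ofReal (Real.sqrt (∑ i, φ (indexPair x₀ (q i)) ^ 2))
        ∂(Measure.pi fun _ : Fin m => (stdGaussian E).prod ν)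
      ≤ ENNReal.ofReal (Real.sqrt m * Real.sqrt (∫ p, φ p ^ 2 ∂(refLaw ν))) := by
  set ρ := Measure.pi fun _ : Fin m => (stdGaussian E).prod ν with hρ
  set R : (Fin m → E × S) → ℝ := fun q => Real.sqrt (∑ i, φ (indexPair x₀ (q i)) ^ 2) with hR
  have hφi : ∀ i : Fin m, Measurable fun q : Fin m → E × S => φ (indexPair x₀ (q i)) :=
    fun i => hφ.comp ((measurable_indexPair x₀).comp (measurable_pi_apply i))
  have hRm : Measurable R := (Finset.measurable_sum _ fun i _ => (hφi i).pow_const 2).sqrt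
  have hR2 : ∀ q, R q ^ 2 = ∑ i, φ (indexPair x₀ (q i)) ^ 2 :=
    fun q => Real.sq_sqrt (Finset.sum_nonneg fun _ _ => sq_nonneg _)
  have hi : ∀ i : Fin m, Integrable (fun q : Fin m → E × S => φ (indexPair x₀ (q i)) ^ 2) ρ :=
    fun i => integrable_comp_eval_indexPair hx₀ (ψ := fun p => φ p ^ 2) hφ2 i
  have hint2 : ∫ q, R q ^ 2 ∂ρ = m * ∫ p, φ p ^ 2 ∂(refLaw ν) := by
    simp_rw [hR2]
    rw [integral_finsetSum _ fun i _ => hi i]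
    rw [Finset.sum_congr rfl fun i _ => integral_comp_eval_indexPair hx₀ (ψ := fun p => φ p ^ 2)
      hφ2.aestronglyMeasurable i]
    simp
  have hmem : MemLp R 2 ρ := by
    rw [memLp_two_iff_integrable_sq hRm.aestronglyMeasurable]
    simp_rw [hR2]
    exact integrable_finsetSum _ fun i _ => hi i
  -- Nonnegativity of the variance of `R` is the inequality `(E R)² ≤ E R²`.
  have hvar := variance_nonneg R ρ
  rw [variance_eq_sub hmem] at hvar
  have hRi : Integrable R ρ := hmem.integrable one_le_two
  rw [← ofReal_integral_eq_lintegral_ofReal hRi (ae_of_all _ fun _ => Real.sqrt_nonneg _)]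
  refine ENNReal.ofReal_le_ofReal ?_
  rw [← Real.sqrt_mul (Nat.cast_nonneg m), ← hint2]
  refine Real.le_sqrt_of_sq_le ?_
  simp only [Pi.pow_apply] at hvar
  linarith

/-- The part of the gradient noise orthogonal to `x₀`. Conditionally on the residuals it is a
Gaussian vector, scaled by the norm of the residual vector. -/
lemma lintegral_supportFun_orthogonal_noise_le {T : Set E} {t : ℝ} (hT : ∀ h ∈ T, ‖h‖ ≤ t)
    (h0 : (0 : E) ∈ T) (hx₀ : ‖x₀‖ = 1) (hφ : Measurable φ)
    (hφ2 : Integrable (fun p => φ p ^ 2) (refLaw ν)) :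
    ∫⁻ q, ENNReal.ofReal (supportFun T
          (∑ i, φ (indexPair x₀ (q i)) • ((q i).1 - ⟪x₀, (q i).1⟫_ℝ • x₀)))
        ∂(Measure.pi fun _ : Fin m => (stdGaussian E).prod ν)
      ≤ ENNReal.ofReal (Real.sqrt m * Real.sqrt (∫ p, φ p ^ 2 ∂(refLaw ν)) *
          ∫ g, supportFun T g ∂(stdGaussian E)) := by
  have hm := measurable_supportFun hT h0
  have hx : ⟪x₀, x₀⟫_ℝ = 1 := by rw [real_inner_self_eq_norm_sq, hx₀]; norm_num
  have hφi : ∀ i : Fin m, Measurable fun q : Fin m → E × S => φ (indexPair x₀ (q i)) :=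
    fun i => hφ.comp ((measurable_indexPair x₀).comp (measurable_pi_apply i))
  have hΦ : Measurable fun q : Fin m → E × S => ENNReal.ofReal (supportFun T
      (∑ i, φ (indexPair x₀ (q i)) • ((q i).1 - ⟪x₀, (q i).1⟫_ℝ • x₀))) :=
    (hm.comp (Finset.measurable_sum _ fun i _ => (hφi i).smul (by fun_prop))).ennreal_ofReal
  rw [lintegral_splice_pi hx₀ hΦ]
  have hinner : ∀ q : Fin m → E × S,
      ∫⁻ b, ENNReal.ofReal (supportFun T (∑ i,
          φ (indexPair x₀ (spliceAlong x₀ ((q i).1, b i), (q i).2)) •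
            (spliceAlong x₀ ((q i).1, b i) - ⟪x₀, spliceAlong x₀ ((q i).1, b i)⟫_ℝ • x₀)))
          ∂(Measure.pi fun _ : Fin m => stdGaussian E)
        ≤ ENNReal.ofReal (Real.sqrt (∑ i, φ (indexPair x₀ (q i)) ^ 2)) *
          ENNReal.ofReal (∫ g, supportFun T g ∂(stdGaussian E)) := by
    intro q
    have hs : ∀ a b : E, ⟪x₀, spliceAlong x₀ (a, b)⟫_ℝ = ⟪x₀, a⟫_ℝ := by
      intro a b
      simp [spliceAlong, inner_add_right, inner_sub_right, real_inner_smul_right, hx₀]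
    have hs2 : ∀ a b : E, spliceAlong x₀ (a, b) - ⟪x₀, a⟫_ℝ • x₀ = b - ⟪x₀, b⟫_ℝ • x₀ := by
      intro a b; simp [spliceAlong]
    simp only [indexPair, hs, hs2]
    set z : Fin m → ℝ := fun i => φ (⟪x₀, (q i).1⟫_ℝ, (q i).2) with hz
    have hlin : ∀ b : Fin m → E, ∑ i, z i • (b i - ⟪x₀, b i⟫_ℝ • x₀)
        = (∑ i, z i • b i) - ⟪x₀, ∑ i, z i • b i⟫_ℝ • x₀ := by
      intro b
      simp only [smul_sub, Finset.sum_sub_distrib, inner_sum, real_inner_smul_right,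
        Finset.sum_smul, smul_smul]
    have hG : Measurable fun g : E => ENNReal.ofReal (supportFun T (g - ⟪x₀, g⟫_ℝ • x₀)) := by
      fun_prop
    have hlaw : ∫⁻ b, ENNReal.ofReal (supportFun T (∑ i, z i • (b i - ⟪x₀, b i⟫_ℝ • x₀)))
          ∂(Measure.pi fun _ : Fin m => stdGaussian E)
        = ENNReal.ofReal (Real.sqrt (∑ i, z i ^ 2)) *
          ∫⁻ g, ENNReal.ofReal (supportFun T (g - ⟪x₀, g⟫_ℝ • x₀)) ∂(stdGaussian E) := by
      simp_rw [hlin]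
      rw [← lintegral_map (g := fun b : Fin m → E => ∑ i, z i • b i) hG
          (Finset.measurable_sum _ fun i _ => by fun_prop),
        map_sum_smul_stdGaussian, lintegral_map hG (by fun_prop), ← lintegral_const_mul _ hG]
      refine lintegral_congr fun g => ?_
      rw [← ENNReal.ofReal_mul (Real.sqrt_nonneg _), ← supportFun_smul (Real.sqrt_nonneg _),
        real_inner_smul_right, smul_sub, smul_smul]
    rw [hlaw]
    gcongr
    exact lintegral_supportFun_orthogonal_le hT h0 hx₀
  refine (lintegral_mono hinner).trans ?_
  rw [lintegral_mul_const' _ _ ENNReal.ofReal_ne_top, ENNReal.ofReal_mul (by positivity)]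
  gcongr
  exact lintegral_norm_residual_le hx₀ hφ hφ2

/-- The part of the gradient noise along `x₀` is a sum of independent centered variables with
variance `∫ φ(g, s)² g²`. -/
lemma lintegral_parallel_noise_sq_le (hx₀ : ‖x₀‖ = 1) (hφ : Measurable φ)
    (hφ2 : Integrable (fun p => φ p ^ 2 * p.1 ^ 2) (refLaw ν))
    (hφ0 : ∫ p, φ p * p.1 ∂(refLaw ν) = 0) :
    ∫⁻ q, ENNReal.ofReal ((∑ i, φ (indexPair x₀ (q i)) * ⟪x₀, (q i).1⟫_ℝ) ^ 2)
        ∂(Measure.pi fun _ : Fin m => (stdGaussian E).prod ν)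
      ≤ ENNReal.ofReal (m * ∫ p, φ p ^ 2 * p.1 ^ 2 ∂(refLaw ν)) := by
  set ψ : ℝ × S → ℝ := fun p => φ p * p.1 with hψ
  have hψm : Measurable ψ := hφ.mul measurable_fst
  have hmp : MeasurePreserving (indexPair x₀) ((stdGaussian E).prod ν) (refLaw ν) :=
    ⟨measurable_indexPair x₀, map_indexPair hx₀⟩
  have hψ2 : MemLp ψ 2 (refLaw ν) := by
    rw [memLp_two_iff_integrable_sq hψm.aestronglyMeasurable]
    simpa only [hψ, mul_pow] using hφ2
  have hX : MemLp (ψ ∘ indexPair x₀) 2 ((stdGaussian E).prod ν) :=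
    hψ2.comp_measurePreserving hmp
  have hvar := variance_sum_pi (μ := fun _ : Fin m => (stdGaussian E).prod ν)
    (X := fun _ => ψ ∘ indexPair x₀) (fun _ => hX)
  have hv1 : Var[ψ ∘ indexPair x₀; (stdGaussian E).prod ν]
      = ∫ p, φ p ^ 2 * p.1 ^ 2 ∂(refLaw ν) := by
    have h := variance_map (μ := (stdGaussian E).prod ν) (X := ψ)
      (by rw [map_indexPair hx₀]; exact hψm.aemeasurable) (measurable_indexPair x₀).aemeasurable
    rw [← h, map_indexPair hx₀, variance_of_integral_eq_zero hψm.aemeasurable hφ0]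
    simp only [hψ, mul_pow]
  set X : (Fin m → E × S) → ℝ := fun q => ∑ i, φ (indexPair x₀ (q i)) * ⟪x₀, (q i).1⟫_ℝ with hXdef
  have hXeq : (∑ i : Fin m, fun q : Fin m → E × S => (ψ ∘ indexPair x₀) (q i)) = X := by
    ext q; simp [hXdef, hψ, indexPair]
  rw [hXeq] at hvar
  simp only [hv1, Finset.sum_const, Finset.card_univ, Fintype.card_fin, nsmul_eq_mul] at hvar
  have hXi : ∀ i : Fin m, MemLp (fun q : Fin m → E × S => (ψ ∘ indexPair x₀) (q i)) 2
      (Measure.pi fun _ : Fin m => (stdGaussian E).prod ν) := fun i =>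
    hX.comp_measurePreserving (measurePreserving_eval (fun _ : Fin m => (stdGaussian E).prod ν) i)
  have hXmem : MemLp X 2 (Measure.pi fun _ : Fin m => (stdGaussian E).prod ν) := by
    rw [← hXeq]
    exact memLp_finsetSum' _ fun i _ => hXi i
  have hX0 : ∫ q, X q ∂(Measure.pi fun _ : Fin m => (stdGaussian E).prod ν) = 0 := by
    have hsum : X = fun q => ∑ i, ψ (indexPair x₀ (q i)) := by
      ext q; simp [hXdef, hψ, indexPair]
    simp only [hsum]
    rw [integral_finsetSum (f := fun i (q : Fin m → E × S) => ψ (indexPair x₀ (q i))) _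
        fun i _ => (hXi i).integrable one_le_two,
      Finset.sum_congr rfl fun i _ => integral_comp_eval_indexPair hx₀ (ψ := ψ)
        hψm.aestronglyMeasurable i]
    simp [hφ0]
  rw [variance_of_integral_eq_zero hXmem.aemeasurable hX0] at hvar
  rw [← hvar, ofReal_integral_eq_lintegral_ofReal hXmem.integrable_sq
    (ae_of_all _ fun _ => sq_nonneg _)]

end Noise

section Exceptional

variable {E S : Type*} [NormedAddCommGroup E] [InnerProductSpace ℝ E] [FiniteDimensional ℝ E]
  [MeasurableSpace E] [BorelSpace E] [MeasurableSpace S] {ν : Measure S} [IsProbabilityMeasure ν]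
  {x₀ : E} {φ : ℝ × S → ℝ} {m : ℕ}

/-- The three stochastic bounds that control the gradient, outside a set of small probability. -/
lemma exists_noise_exceptional_set {T : Set E} {t : ℝ} (hT : ∀ h ∈ T, ‖h‖ ≤ t) (h0 : (0 : E) ∈ T)
    (ht : 0 < t) (hm : 0 < m) (hw : ∫ g, supportFun T g ∂(stdGaussian E) ≤ t * Real.sqrt m)
    (hx₀ : ‖x₀‖ = 1) (hφ : Measurable φ) (hσ : Integrable (fun p => φ p ^ 2) (refLaw ν))
    (hη : Integrable (fun p => φ p ^ 2 * p.1 ^ 2) (refLaw ν))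
    (hφ0 : ∫ p, φ p * p.1 ∂(refLaw ν) = 0) {e : ℝ} (he : 0 < e) (he1 : e ≤ 1) :
    ∃ B : Set (Fin m → E × S), MeasurableSet B ∧
      (Measure.pi fun _ : Fin m => (stdGaussian E).prod ν) B ≤ ENNReal.ofReal (3 * e) ∧
      ∀ q ∉ B,
        |∑ i, φ (indexPair x₀ (q i)) * ⟪x₀, (q i).1⟫_ℝ|
            ≤ Real.sqrt m * Real.sqrt (∫ p, φ p ^ 2 * p.1 ^ 2 ∂(refLaw ν)) / Real.sqrt e ∧
        supportFun T (∑ i, (-φ (indexPair x₀ (q i))) • ((q i).1 - ⟪x₀, (q i).1⟫_ℝ • x₀))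
            ≤ Real.sqrt m * Real.sqrt (∫ p, φ p ^ 2 ∂(refLaw ν)) *
              (∫ g, supportFun T g ∂(stdGaussian E)) / e ∧
        ∀ h ∈ T, ∑ i, ⟪(q i).1, h⟫_ℝ ^ 2 ≤ 32 * (1 + Real.log (1 / e)) * t ^ 2 * m := by
  set ρ := Measure.pi fun _ : Fin m => (stdGaussian E).prod ν with hρ
  set w := ∫ g, supportFun T g ∂(stdGaussian E) with hwdef
  set V := ∫ p, φ p ^ 2 * p.1 ^ 2 ∂(refLaw ν) with hV
  set s := Real.sqrt (∫ p, φ p ^ 2 ∂(refLaw ν)) with hs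
  have hsup := measurable_supportFun hT h0
  have hφi : ∀ i : Fin m, Measurable fun q : Fin m → E × S => φ (indexPair x₀ (q i)) :=
    fun i => hφ.comp ((measurable_indexPair x₀).comp (measurable_pi_apply i))
  have hpar := lintegral_parallel_noise_sq_le (m := m) hx₀ hφ hη hφ0
  have horth := lintegral_supportFun_orthogonal_noise_le (m := m) (ν := ν) (φ := fun p => -φ p)
    hT h0 hx₀ hφ.neg (by simpa using hσ)
  simp only [neg_sq] at horth
  have hmix : ∫⁻ q, gaussianMix T (1 / (4 * t)) (fun i => (q i).1) ∂ρ
      ≤ ENNReal.ofReal (Real.exp m) := by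
    have h1 := measurePreserving_pi (fun _ : Fin m => (stdGaussian E).prod ν)
      (fun _ : Fin m => stdGaussian E) fun _ => measurePreserving_fst
    have h2 := h1.lintegral_comp (measurable_gaussianMix hT h0 m (1 / (4 * t)))
    exact h2.trans_le (lintegral_gaussianMix_le hT h0 ht hw)
  have hmeas1 : Measurable fun q : Fin m → E × S =>
      ENNReal.ofReal ((∑ i, φ (indexPair x₀ (q i)) * ⟪x₀, (q i).1⟫_ℝ) ^ 2) :=
    ((Finset.measurable_sum _ fun i _ => (hφi i).mul (by fun_prop)).pow_const 2).ennreal_ofReal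
  have hmeas2 : Measurable fun q : Fin m → E × S => ENNReal.ofReal (supportFun T
      (∑ i, (-φ (indexPair x₀ (q i))) • ((q i).1 - ⟪x₀, (q i).1⟫_ℝ • x₀))) :=
    (hsup.comp (Finset.measurable_sum _ fun i _ =>
      (hφi i).neg.smul (by fun_prop))).ennreal_ofReal
  have hmeas3 : Measurable fun q : Fin m → E × S =>
      gaussianMix T (1 / (4 * t)) (fun i => (q i).1) :=
    (measurable_gaussianMix hT h0 m (1 / (4 * t))).comp
      (measurable_pi_lambda _ fun i => by fun_prop)
  have b1 := measure_lt_le_of_lintegral_le hmeas1.aemeasurable ENNReal.ofReal_ne_top hpar he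
  have b2 := measure_lt_le_of_lintegral_le hmeas2.aemeasurable ENNReal.ofReal_ne_top horth he
  have b3 := measure_lt_le_of_lintegral_le hmeas3.aemeasurable ENNReal.ofReal_ne_top hmix he
  have hU := (measure_union_le _ _).trans (add_le_add b1 ((measure_union_le _ _).trans
    (add_le_add b2 b3)))
  refine ⟨toMeasurable ρ _, measurableSet_toMeasurable _ _,
    (measure_toMeasurable _).trans_le (hU.trans_eq ?_), ?_⟩
  · rw [← ENNReal.ofReal_add he.le he.le, ← ENNReal.ofReal_add he.le (by positivity)]
    ring_nf
  · intro q hq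
    replace hq := mt (fun h => subset_toMeasurable ρ _ h) hq
    simp only [Set.mem_union, Set.mem_ofPred_eq, not_or, not_lt] at hq
    obtain ⟨q1, q2, q3⟩ := hq
    have hV0 : 0 ≤ V := integral_nonneg fun p => by positivity
    have hw0 : 0 ≤ w := integral_nonneg fun g => supportFun_nonneg hT h0 g
    refine ⟨?_, ?_, fun h hh => sum_inner_sq_le_of_gaussianMix_le hT ht hm he he1 q3 hh⟩
    · rw [← ENNReal.ofReal_div_of_pos he, ENNReal.ofReal_le_ofReal_iff (by positivity)] at q1
      rw [← Real.sqrt_mul (Nat.cast_nonneg m), ← Real.sqrt_div (by positivity)]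
      exact Real.abs_le_sqrt q1
    · rwa [← ENNReal.ofReal_div_of_pos he, ENNReal.ofReal_le_ofReal_iff
        (div_nonneg (mul_nonneg (by positivity) hw0) he.le)] at q2

end Exceptional

section Splitting

variable {E : Type*} [NormedAddCommGroup E] [InnerProductSpace ℝ E] {x₀ : E} {m : ℕ}

/-- Splitting the gradient in a direction `h ∈ T` into the noise along `x₀`, the noise orthogonal
to `x₀` and the contribution of the corruption `z' - z` of the residuals. -/
lemma neg_sum_residual_inner_le {T : Set E} {t : ℝ} (hT : ∀ h ∈ T, ‖h‖ ≤ t) (hx₀ : ‖x₀‖ = 1)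
    (a : Fin m → E) (z z' : Fin m → ℝ) {h : E} (hh : h ∈ T) :
    -∑ i, z' i * ⟪a i, h⟫_ℝ ≤ |∑ i, z i * ⟪x₀, a i⟫_ℝ| * t
      + supportFun T (∑ i, (-z i) • (a i - ⟪x₀, a i⟫_ℝ • x₀))
      + Real.sqrt (∑ i, (z' i - z i) ^ 2) * Real.sqrt (∑ i, ⟪a i, h⟫_ℝ ^ 2) := by
  have h1 : -((∑ i, z i * ⟪x₀, a i⟫_ℝ) * ⟪x₀, h⟫_ℝ) ≤ |∑ i, z i * ⟪x₀, a i⟫_ℝ| * t := by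
    refine (neg_le_abs _).trans ?_
    rw [abs_mul]
    have h2 := abs_real_inner_le_norm x₀ h
    rw [hx₀, one_mul] at h2
    exact mul_le_mul_of_nonneg_left (h2.trans (hT h hh)) (abs_nonneg _)
  have h2 := inner_le_supportFun hT (∑ i, (-z i) • (a i - ⟪x₀, a i⟫_ℝ • x₀)) hh
  have h3 := Real.sum_mul_le_sqrt_mul_sqrt Finset.univ (fun i => -(z' i - z i))
    (fun i => ⟪a i, h⟫_ℝ)
  simp only [neg_sq] at h3
  have h4 : -∑ i, z' i * ⟪a i, h⟫_ℝ = -((∑ i, z i * ⟪x₀, a i⟫_ℝ) * ⟪x₀, h⟫_ℝ)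
      + ⟪∑ i, (-z i) • (a i - ⟪x₀, a i⟫_ℝ • x₀), h⟫_ℝ
      + ∑ i, -(z' i - z i) * ⟪a i, h⟫_ℝ := by
    simp only [sum_inner, real_inner_smul_left, inner_sub_left, Finset.sum_mul,
      ← Finset.sum_neg_distrib, ← Finset.sum_add_distrib]
    refine Finset.sum_congr rfl fun i _ => ?_
    ring
  rw [h4]
  exact add_le_add (add_le_add h1 h2) h3

end Splitting

/-! ### The empirical loss -/

section Loss

variable {𝒴 : Set ℝ} {ℒ : ℝ → 𝒴 → ℝ} {Λ : ℝ}

lemma IsRegularLoss.hasDerivAt (hℒ : IsRegularLoss ℒ Λ) (v : ℝ) (y : 𝒴) :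
    HasDerivAt (fun u => ℒ u y) (lossDeriv ℒ v y) v :=
  ((hℒ.contDiff y).differentiable one_ne_zero v).hasDerivAt

lemma IsRegularLoss.continuous_lossDeriv (hℒ : IsRegularLoss ℒ Λ) :
    Continuous fun p : ℝ × 𝒴 => lossDeriv ℒ p.1 p.2 := by
  rw [continuous_iff_continuousAt]
  rintro ⟨v₀, y₀⟩
  have hv : Continuous fun v => lossDeriv ℒ v y₀ := (hℒ.contDiff y₀).continuous_deriv le_rfl
  rw [ContinuousAt, tendsto_iff_dist_tendsto_zero]
  have hlim : Filter.Tendsto (fun p : ℝ × 𝒴 => Λ * |(p.2 : ℝ) - (y₀ : ℝ)|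
      + |lossDeriv ℒ p.1 y₀ - lossDeriv ℒ v₀ y₀|) (nhds (v₀, y₀)) (nhds 0) := by
    have hc : Continuous fun p : ℝ × 𝒴 => Λ * |(p.2 : ℝ) - (y₀ : ℝ)|
        + |lossDeriv ℒ p.1 y₀ - lossDeriv ℒ v₀ y₀| := by fun_prop
    simpa using hc.tendsto (v₀, y₀)
  refine squeeze_zero (fun _ => dist_nonneg) (fun p => ?_) hlim
  rw [Real.dist_eq]
  have h1 := hℒ.lipschitz p.1 p.2 y₀
  have h2 := abs_sub_le (lossDeriv ℒ p.1 p.2) (lossDeriv ℒ p.1 y₀) (lossDeriv ℒ v₀ y₀)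
  linarith

lemma IsRegularLoss.measurable_lossResidual {S : Type*} [MeasurableSpace S]
    (hℒ : IsRegularLoss ℒ Λ) {f : ℝ → S → 𝒴} (hf : Measurable fun p : ℝ × S => f p.1 p.2)
    (μ : ℝ) : Measurable (lossResidual ℒ f μ) :=
  hℒ.continuous_lossDeriv.measurable.comp ((measurable_fst.const_mul μ).prodMk hf)

variable {n m : ℕ} {a : Fin m → EuclideanSpace ℝ (Fin n)} {y : Fin m → 𝒴}

lemma IsRegularLoss.inner_gradient_empLoss (hℒ : IsRegularLoss ℒ Λ)
    (b h : EuclideanSpace ℝ (Fin n)) :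
    ⟪gradient (empLoss ℒ a y) b, h⟫_ℝ
      = (1 / (m : ℝ)) * ∑ i, lossDeriv ℒ ⟪a i, b⟫_ℝ (y i) * ⟪a i, h⟫_ℝ := by
  have h1 : ∀ i, HasFDerivAt (fun x => ℒ ⟪a i, x⟫_ℝ (y i))
      (lossDeriv ℒ ⟪a i, b⟫_ℝ (y i) • innerSL ℝ (a i)) b := fun i =>
    (hℒ.hasDerivAt _ (y i)).comp_hasFDerivAt b (innerSL ℝ (a i)).hasFDerivAt
  have h2 : HasFDerivAt (empLoss ℒ a y)
      ((1 / (m : ℝ)) • ∑ i, lossDeriv ℒ ⟪a i, b⟫_ℝ (y i) • innerSL ℝ (a i)) b :=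
    (HasFDerivAt.fun_sum fun i _ => h1 i).const_mul _
  rw [gradient, InnerProductSpace.toDual_symm_apply, h2.fderiv]
  simp

lemma IsRegularLoss.empLoss_convex (hℒ : IsRegularLoss ℒ Λ) {s : ℝ} (hs : 0 ≤ s) (hs1 : s ≤ 1)
    (x b : EuclideanSpace ℝ (Fin n)) :
    empLoss ℒ a y ((1 - s) • b + s • x) ≤ (1 - s) * empLoss ℒ a y b + s * empLoss ℒ a y x := by
  have h1 : ∀ i, ℒ ⟪a i, (1 - s) • b + s • x⟫_ℝ (y i)
      ≤ (1 - s) * ℒ ⟪a i, b⟫_ℝ (y i) + s * ℒ ⟪a i, x⟫_ℝ (y i) := by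
    intro i
    rw [inner_add_right, real_inner_smul_right, real_inner_smul_right]
    exact (hℒ.convex (y i)).2 (Set.mem_univ _) (Set.mem_univ _) (by linarith) hs (by ring)
  have h2 := Finset.sum_le_sum fun i (_ : i ∈ Finset.univ) => h1 i
  rw [Finset.sum_add_distrib, ← Finset.mul_sum, ← Finset.mul_sum] at h2
  have h3 := mul_le_mul_of_nonneg_left h2 (show 0 ≤ 1 / (m : ℝ) by positivity)
  simp only [empLoss]
  linarith

/-- Localization: if the linear part of the loss at `b` cannot compensate the quadratic growth on
the sphere of radius `t`, then convexity keeps every minimizer inside this sphere. -/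
lemma IsRegularLoss.norm_estimate_sub_le (hℒ : IsRegularLoss ℒ Λ)
    {K : Set (EuclideanSpace ℝ (Fin n))} (hK : Convex ℝ K) {b : EuclideanSpace ℝ (Fin n)}
    (hb : b ∈ K) {c t : ℝ} (ht : 0 < t) (hrsc : RSCWith c ℒ a y t b K)
    (hgrad : ∀ x ∈ K, ‖x - b‖ = t → -⟪gradient (empLoss ℒ a y) b, x - b⟫_ℝ < c * t ^ 2)
    {xhat : EuclideanSpace ℝ (Fin n)} (hx : IsEstimate ℒ a y K xhat) : ‖xhat - b‖ ≤ t := by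
  by_contra! hlt
  have hr : 0 < ‖xhat - b‖ := ht.trans hlt
  set s := t / ‖xhat - b‖ with hs
  have hs0 : 0 ≤ s := by positivity
  have hs1 : s ≤ 1 := (div_le_one hr).2 hlt.le
  set x := (1 - s) • b + s • xhat with hxdef
  have hxK : x ∈ K := hK hb hx.1 (by linarith) hs0 (by ring)
  have hxb : x - b = s • (xhat - b) := by rw [hxdef]; module
  have hnorm : ‖x - b‖ = t := by
    rw [hxb, norm_smul, Real.norm_eq_abs, abs_of_nonneg hs0, hs, div_mul_cancel₀ _ hr.ne']
  have h1 := hrsc x ⟨hxK, by rw [mem_sphere_iff_norm, hnorm]⟩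
  have h2 : empLoss ℒ a y xhat ≤ empLoss ℒ a y b := hx.2 hb
  have h3 := hℒ.empLoss_convex (a := a) (y := y) hs0 hs1 xhat b
  have h4 := hgrad x hxK hnorm
  rw [taylorError, hnorm] at h1
  have h5 := mul_le_mul_of_nonneg_left h2 hs0
  linarith

end Loss

/-! ### Combining the bounds -/

section Assembly

variable {n m : ℕ} {𝒴 : Set ℝ} {ℒ : ℝ → 𝒴 → ℝ} {Λ : ℝ}

/-- Outside the exceptional set of `exists_noise_exceptional_set` the gradient at the target is small in all
directions of `T`, at the scale required by the localization argument. -/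
lemma IsRegularLoss.neg_inner_gradient_lt {S : Type*} [MeasurableSpace S] {ν : Measure S}
    (hℒ : IsRegularLoss ℒ Λ) (hΛ : 0 < Λ) {c e t μ κ : ℝ} (hc : 0 < c) (he : 0 < e) (ht : 0 < t)
    (hm : 0 < m) {f : ℝ → S → 𝒴} {x₀ : EuclideanSpace ℝ (Fin n)} (hx₀ : ‖x₀‖ = 1)
    {a : Fin m → EuclideanSpace ℝ (Fin n)} {ξ : Fin m → S} {y : Fin m → 𝒴}
    {T : Set (EuclideanSpace ℝ (Fin n))} (hT : ∀ h ∈ T, ‖h‖ ≤ t) {d : ℝ}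
    (h1 : |∑ i, lossResidual ℒ f μ (indexPair x₀ (a i, ξ i)) * ⟪x₀, a i⟫_ℝ|
      ≤ Real.sqrt m * etaParam ℒ f ν μ / Real.sqrt e)
    (h2 : supportFun T (∑ i, (-lossResidual ℒ f μ (indexPair x₀ (a i, ξ i))) •
        (a i - ⟪x₀, a i⟫_ℝ • x₀)) ≤ Real.sqrt m * sigmaParam ℒ f ν μ * (t * Real.sqrt d) / e)
    (h3 : ∀ h ∈ T, ∑ i, ⟪a i, h⟫_ℝ ^ 2 ≤ κ * t ^ 2 * m)
    (hC : (1 / Real.sqrt e + 1 / e + Λ * Real.sqrt κ) / c *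
      ((sigmaParam ℒ f ν μ * Real.sqrt d + etaParam ℒ f ν μ) / Real.sqrt m
        + advNoise y (observation f a ξ x₀)) < t) {h : EuclideanSpace ℝ (Fin n)} (hh : h ∈ T) :
    -⟪gradient (empLoss ℒ a y) (μ • x₀), h⟫_ℝ < c * t ^ 2 := by
  set σ := sigmaParam ℒ f ν μ with hσ
  set η := etaParam ℒ f ν μ with hη
  set ε := advNoise y (observation f a ξ x₀) with hε
  set r := Real.sqrt m with hr
  have hm0 : (0 : ℝ) < m := by exact_mod_cast hm
  have hr0 : 0 < r := Real.sqrt_pos.2 hm0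
  have hrm : r ^ 2 = m := Real.sq_sqrt hm0.le
  have hσ0 : 0 ≤ σ := Real.sqrt_nonneg _
  have hη0 : 0 ≤ η := Real.sqrt_nonneg _
  have hε0 : 0 ≤ ε := Real.sqrt_nonneg _
  set z : Fin m → ℝ := fun i => lossResidual ℒ f μ (indexPair x₀ (a i, ξ i)) with hz
  set z' : Fin m → ℝ := fun i => lossDeriv ℒ ⟪a i, μ • x₀⟫_ℝ (y i) with hz'
  have hdiff : ∑ i, (z' i - z i) ^ 2 ≤ (Λ * (r * ε)) ^ 2 := by
    have hi : ∀ i, (z' i - z i) ^ 2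
        ≤ Λ ^ 2 * |(y i : ℝ) - (observation f a ξ x₀ i : ℝ)| ^ 2 := by
      intro i
      have hl := hℒ.lipschitz (⟪a i, μ • x₀⟫_ℝ) (y i) (observation f a ξ x₀ i)
      have he : z i = lossDeriv ℒ ⟪a i, μ • x₀⟫_ℝ (observation f a ξ x₀ i) := by
        simp only [hz, lossResidual, indexPair, observation, real_inner_smul_right,
          real_inner_comm]
      rw [← mul_pow, ← sq_abs (z' i - z i), he]
      exact pow_le_pow_left₀ (abs_nonneg _) hl 2
    have hs := Finset.sum_le_sum fun i (_ : i ∈ Finset.univ) => hi i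
    rw [← Finset.mul_sum] at hs
    have hεsq : (r * ε) ^ 2 = ∑ i, |(y i : ℝ) - (observation f a ξ x₀ i : ℝ)| ^ 2 := by
      rw [mul_pow, hrm, hε, advNoise, Real.sq_sqrt (by positivity)]
      field_simp
    rw [mul_pow, hεsq]
    exact hs
  have hcorr : Real.sqrt (∑ i, (z' i - z i) ^ 2) ≤ Λ * (r * ε) :=
    Real.sqrt_le_iff.2 ⟨by positivity, hdiff⟩
  have hmat : Real.sqrt (∑ i, ⟪a i, h⟫_ℝ ^ 2) ≤ Real.sqrt κ * t * r := by
    refine (Real.sqrt_le_sqrt (h3 h hh)).trans_eq ?_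
    rw [Real.sqrt_mul' _ hm0.le, Real.sqrt_mul' _ (sq_nonneg t), Real.sqrt_sq ht.le]
  have hsplit := neg_sum_residual_inner_le hT hx₀ a z z' hh
  have hbound : -∑ i, z' i * ⟪a i, h⟫_ℝ ≤ r * η / Real.sqrt e * t
      + r * σ * (t * Real.sqrt d) / e + Λ * (r * ε) * (Real.sqrt κ * t * r) := by
    refine hsplit.trans (add_le_add (add_le_add (mul_le_mul_of_nonneg_right h1 ht.le) h2) ?_)
    exact mul_le_mul hcorr hmat (Real.sqrt_nonneg _) (by positivity)
  rw [hℒ.inner_gradient_empLoss, ← mul_neg]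
  have hscale : 1 / (m : ℝ) * (r * η / Real.sqrt e * t
      + r * σ * (t * Real.sqrt d) / e + Λ * (r * ε) * (Real.sqrt κ * t * r))
      = t * (1 / Real.sqrt e * (η / r) + 1 / e * (σ * Real.sqrt d / r)
        + Λ * Real.sqrt κ * ε) := by
    have : Real.sqrt e ≠ 0 := (Real.sqrt_pos.2 he).ne'
    rw [← hrm]
    field_simp
  have hA : 0 ≤ η / r := by positivity
  have hB : 0 ≤ σ * Real.sqrt d / r := by positivity
  have hα : 0 ≤ 1 / Real.sqrt e := by positivity
  have hβ : 0 ≤ 1 / e := by positivity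
  have hγ : 0 ≤ Λ * Real.sqrt κ := by positivity
  rw [div_mul_eq_mul_div, div_lt_iff₀ hc, add_div] at hC
  have hsum : 1 / Real.sqrt e * (η / r) + 1 / e * (σ * Real.sqrt d / r) + Λ * Real.sqrt κ * ε
      ≤ (1 / Real.sqrt e + 1 / e + Λ * Real.sqrt κ) * (σ * Real.sqrt d / r + η / r + ε) := by
    nlinarith [mul_nonneg hα hB, mul_nonneg hα hε0, mul_nonneg hβ hA, mul_nonneg hβ hε0,
      mul_nonneg hγ hA, mul_nonneg hγ hB]
  calc 1 / (m : ℝ) * -∑ i, z' i * ⟪a i, h⟫_ℝ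
      ≤ 1 / (m : ℝ) * (r * η / Real.sqrt e * t
        + r * σ * (t * Real.sqrt d) / e + Λ * (r * ε) * (Real.sqrt κ * t * r)) := by gcongr
    _ = t * (1 / Real.sqrt e * (η / r) + 1 / e * (σ * Real.sqrt d / r)
        + Λ * Real.sqrt κ * ε) := hscale
    _ ≤ t * ((1 / Real.sqrt e + 1 / e + Λ * Real.sqrt κ) *
        (σ * Real.sqrt d / r + η / r + ε)) := by gcongr
    _ < t * (t * c) := by gcongr
    _ = c * t ^ 2 := by ring

lemma IsGaussianSample.hasLaw_pi {Ω S : Type*} [MeasurableSpace Ω] [MeasurableSpace S]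
    {P : Measure Ω} [IsProbabilityMeasure P] {ν : Measure S} [IsProbabilityMeasure ν]
    {a : Fin m → Ω → EuclideanSpace ℝ (Fin n)} {ξ : Fin m → Ω → S}
    (hs : IsGaussianSample P ν a ξ) :
    HasLaw (fun ω i => (a i ω, ξ i ω))
      (Measure.pi fun _ : Fin m => (stdGaussian (EuclideanSpace ℝ (Fin n))).prod ν) P :=
  hs.indep.hasLaw_pi fun i => (hs.indep_noise i).hasLaw_prod (hs.law_vector i) (hs.law_noise i)

end Assembly

end SingleIndex

theorem mainTheorem1 (δ : ℝ) (hδ₀ : 0 < δ) (hδ₁ : δ < 1)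
    (Λ : ℝ) (hΛ : 0 < Λ) (c : ℝ) (hc : 0 < c) :
    ∃ C : ℝ, 0 < C ∧
      ∀ (Ω S : Type*) [MeasurableSpace Ω] [MeasurableSpace S]
        (P : Measure Ω) [IsProbabilityMeasure P] (ν : Measure S) [IsProbabilityMeasure ν]
        (n m : ℕ) (_hm : 0 < m)
        (𝒴 : Set ℝ) (_h𝒴 : IsClosed 𝒴)
        (f : ℝ → S → 𝒴) (_hf : Measurable (fun p : ℝ × S => f p.1 p.2))
        (ℒ : ℝ → 𝒴 → ℝ) (_hℒ : SingleIndex.IsRegularLoss ℒ Λ)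
        (a : Fin m → Ω → EuclideanSpace ℝ (Fin n)) (ξ : Fin m → Ω → S)
        (_hsample : SingleIndex.IsGaussianSample P ν a ξ)
        (ytilde : Ω → Fin m → 𝒴)
        (x₀ : EuclideanSpace ℝ (Fin n)) (_hx₀ : ‖x₀‖ = 1)
        (μ : ℝ) (_hμ : SingleIndex.IsScalingParameter ℒ f ν μ)
        (K : Set (EuclideanSpace ℝ (Fin n))) (_hK : Convex ℝ K) (_hμK : μ • x₀ ∈ K)
        (t : ℝ) (_ht : 0 < t)
        (_hdim : SingleIndex.effDim t ((fun x => x - μ • x₀) '' K) ≤ (m : ℝ)),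
        ∃ G : Set Ω, MeasurableSet G ∧ ENNReal.ofReal (1 - δ) ≤ P G ∧
          ∀ ω ∈ G,
            SingleIndex.RSCWith c ℒ (fun i => a i ω) (ytilde ω) t (μ • x₀) K →
            C * ((SingleIndex.sigmaParam ℒ f ν μ
                    * Real.sqrt (SingleIndex.effDim t ((fun x => x - μ • x₀) '' K))
                  + SingleIndex.etaParam ℒ f ν μ) / Real.sqrt (m : ℝ)
                + SingleIndex.advNoise (ytilde ω)
                    (SingleIndex.observation f (fun i => a i ω) (fun i => ξ i ω) x₀)) < t →
            ∀ xhat : EuclideanSpace ℝ (Fin n),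
              SingleIndex.IsEstimate ℒ (fun i => a i ω) (ytilde ω) K xhat →
              ‖xhat - μ • x₀‖ ≤ t := by
  -- Each of the three exceptional events gets probability `δ / 3`.
  have he : 0 < δ / 3 := by positivity
  have he1 : δ / 3 ≤ 1 := by linarith
  refine ⟨(1 / Real.sqrt (δ / 3) + 1 / (δ / 3)
    + Λ * Real.sqrt (32 * (1 + Real.log (1 / (δ / 3))))) / c, by positivity, ?_⟩
  intro Ω S _ _ P _ ν _ n m hm 𝒴 _ f hf ℒ hℒ a ξ hsample ytilde x₀ hx₀ μ hμ K hK hμK t ht hdim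
  set T : Set (EuclideanSpace ℝ (Fin n)) :=
    ((fun x => x - μ • x₀) '' K) ∩ Metric.closedBall 0 t with hTdef
  set d := SingleIndex.effDim t ((fun x => x - μ • x₀) '' K) with hd
  have hT : ∀ h ∈ T, ‖h‖ ≤ t := fun h hh => mem_closedBall_zero_iff.1 hh.2
  have h0 : (0 : EuclideanSpace ℝ (Fin n)) ∈ T :=
    ⟨⟨μ • x₀, hμK, sub_self _⟩, Metric.mem_closedBall_self ht.le⟩
  set w := ∫ g, SingleIndex.supportFun T g ∂(stdGaussian (EuclideanSpace ℝ (Fin n))) with hw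
  have hw0 : 0 ≤ w := integral_nonneg fun g => SingleIndex.supportFun_nonneg hT h0 g
  have hwd : w = t * Real.sqrt d := by
    have hdw : d = (w / t) ^ 2 := (div_pow w t 2).symm
    rw [hdw, Real.sqrt_sq (by positivity)]
    field_simp
  obtain ⟨B, hBm, hBP, hB⟩ := SingleIndex.exists_noise_exceptional_set (m := m) (ν := ν) hT h0 ht hm
    (by rw [← hw, hwd]; gcongr) hx₀ (hℒ.measurable_lossResidual hf μ) hμ.integrable_sigma
    hμ.integrable_eta hμ.mean_zero he he1
  have hlaw := hsample.hasLaw_pi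
  set X : Ω → Fin m → EuclideanSpace ℝ (Fin n) × S := fun ω i => (a i ω, ξ i ω) with hX
  have hXB : P (toMeasurable P (X ⁻¹' B)) ≤ ENNReal.ofReal δ := by
    rw [measure_toMeasurable, ← Measure.map_apply_of_aemeasurable hlaw.aemeasurable hBm,
      hlaw.map_eq]
    simpa [mul_div_cancel₀] using hBP
  -- The sample is only almost everywhere measurable, so the preimage of the exceptional set is
  -- enlarged to a measurable set.
  refine ⟨(toMeasurable P (X ⁻¹' B))ᶜ, (measurableSet_toMeasurable _ _).compl, ?_, ?_⟩
  · rw [prob_compl_eq_one_sub (measurableSet_toMeasurable _ _), ENNReal.ofReal_sub _ hδ₀.le,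
      ENNReal.ofReal_one]
    exact tsub_le_tsub_left hXB _
  · intro ω hω hrsc hC xhat hxhat
    have hωB : X ω ∉ B := fun h => hω (subset_toMeasurable P _ h)
    obtain ⟨q1, q2, q3⟩ := hB (X ω) hωB
    rw [← hw, hwd] at q2
    refine hℒ.norm_estimate_sub_le hK hμK ht hrsc (fun x hx hxt => ?_) hxhat
    exact hℒ.neg_inner_gradient_lt hΛ hc he ht hm hx₀ hT q1 q2 q3 hC
      ⟨⟨x, hx, rfl⟩, mem_closedBall_zero_iff.2 hxt.le⟩
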